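/- Let $p$ be a prime, $K\subset\mathbf C_p$ a finite extension of $\mathbf Q_p$ with ring of integers $\mathcal O_K$, maximal ideal $\mathfrak m_K=\pi\mathcal O_K$, residue degree $f$ and ramification index $e$. Let $v_p$, $v_\pi=e\,v_p$ be the additive valuations of $\mathbf C_p$ with $v_p(p)=1$, $v_\pi(\pi)=1$ and value $+\infty$ at $0$. For a power series $F=\sum F_iX^i$ over $\mathcal O_K$ let $\mathrm{wideg}(F)$ be the smallest index $n$, and $\mathrm{Lwideg}(F)$ the largest index $m$ (if it exists), at which the minimum of the values $v_p(F_i)$ is attained. With zeros counted with multiplicity, put $$\mathrm{Res}^o(F,G)=F_n^{N}\prod_{|z|<1,\ F(z)=0}G(z),\qquad \mathrm{Res}^c(F,G)=F_m^{M}\prod_{|z|\le 1,\ F(z)=0}G(z)\qquad(z\in\mathbf C_p),$$ where $n=\mathrm{wideg}(F)$, $N=\mathrm{wideg}(G)$, $m=\mathrm{Lwideg}(F)$, $M=\mathrm{Lwideg}(G)$ (the second for series that converge on $\mathcal O_{\mathbf C_p}$). Put $$\alpha(j)=\sum_{k\ge1}\Big\lfloor\frac{j}{p^{kf}}\Big\rfloor,\quad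 \beta(m)=\min\{j\ge 0:\alpha(j)\ge m\},\quad B(s)=\sum_{m=1}^s\beta(m),$$ $$\alpha'(j)=j+\alpha(j),\quad \beta'(m)=\min\{j\ge 0:\alpha'(j)\ge m\},\quad B'(s)=\sum_{m=1}^s\beta'(m).$$ **Theorem 3.4.** Let $F,G$ be power series with coefficients in $\mathcal O_K$, of finite Weierstrass degrees $\mathrm{wideg}(F)=n$ and $\mathrm{wideg}(G)=N$, such that $F_n$ and $G_N$ are units. (i) Suppose that $F$ and $G$ have no common zero in $\mathfrak m_K$. Then $\phi(x)=\min(v_\pi(F(x)),v_\pi(G(x)))$ has a maximum $S'$ and a minimum $s'$ on $\mathfrak m_K$, both are non-negative integers, and for every integer $t\ge0$ $$v_\pi(\mathrm{Res}^o(F,G))-S'\ \ge\ B'(s'+t)-2B'(t)-s'.$$ Equivalently, with the maximum $S'_K=S'/e$ and the minimum $s'_K=s'/e$ of $\min(v_p(F(x)),v_p(G(x)))$ on $\mathfrak m_K$, $$v_p(\mathrm{Res}^o(F,G))-S'_K\ \ge\ \tfrac1e\big(B'(es'_K+t)-2B'(t)-es'_K\big).$$ (ii) Suppose that $F$ and $G$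 converge on $\mathcal O_{\mathbf C_p}$ and have no common zero in $\mathcal O_K$. Then $\phi$ has a maximum $S$ and a minimum $s$ on $\mathcal O_K$, both are non-negative integers, and for every integer $t\ge0$ $$v_\pi(\mathrm{Res}^c(F,G))-S\ \ge\ B(s+t)-2B(t)-s.$$ Equivalently, with the maximum $S_K=S/e$ and the minimum $s_K=s/e$ of $\min(v_p(F(x)),v_p(G(x)))$ on $\mathcal O_K$, $$v_p(\mathrm{Res}^c(F,G))-S_K\ \ge\ \tfrac1e\big(B(es_K+t)-2B(t)-es_K\big).$$ -/

import Mathlib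

open scoped PowerSeries PadicComplex

noncomputable section

namespace PadicResultant

/-! ### The counting functions -/

/-- `α(j) = ∑_{k ≥ 1} ⌊j / p^{kf}⌋`. For `p ≥ 2` and `f ≥ 1` the terms with `k > j` vanish, so the
sum is taken over `1 ≤ k ≤ j`. -/
def alpha (p f j : ℕ) : ℕ := ∑ k ∈ Finset.Icc 1 j, j / p ^ (k * f)

/-- `β(m) = min {j : α(j) ≥ m}`. -/
def beta (p f m : ℕ) : ℕ := sInf {j | m ≤ alpha p f j}

/-- `B(s) = ∑_{m=1}^{s} β(m)`. -/
def bigB (p f s : ℕ) : ℕ := ∑ m ∈ Finset.Icc 1 s, beta p f m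

/-- `α'(j) = j + ∑_{k ≥ 1} ⌊j / p^{kf}⌋`. -/
def alpha' (p f j : ℕ) : ℕ := j + alpha p f j

/-- `β'(m) = min {j : α'(j) ≥ m}`. -/
def beta' (p f m : ℕ) : ℕ := sInf {j | m ≤ alpha' p f j}

/-- `B'(s) = ∑_{m=1}^{s} β'(m)`. -/
def bigB' (p f s : ℕ) : ℕ := ∑ m ∈ Finset.Icc 1 s, beta' p f m

variable {p : ℕ} [Fact p.Prime]

/-! ### Valuations and power series over `ℂ_p` -/

/-- The additive valuation `v` on `ℂ_p` that extends the `p`-adic one up to scaling and is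
normalized by `v(ϖ) = 1` (for `0 < |ϖ| < 1`): `v(x) = log |x| / log |ϖ|`, and `v(0) = ∞`.
With `ϖ = p` it is `v_p`, with `ϖ` a uniformizer `π` of `K` it is `v_π`. -/
def val (ϖ x : ℂ_[p]) : EReal :=
  open Classical in
  if x = 0 then ⊤ else ((Real.log ‖x‖ / Real.log ‖ϖ‖ : ℝ) : EReal)

/-- The value `F(z) = ∑ F_i z^i`. -/
def evalAt (F : ℂ_[p]⟦X⟧) (z : ℂ_[p]) : ℂ_[p] := ∑' i : ℕ, PowerSeries.coeff i F * z ^ i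

/-- `F` converges at every point of `D`. -/
def ConvergesOn (F : ℂ_[p]⟦X⟧) (D : Set ℂ_[p]) : Prop :=
  ∀ z ∈ D, Summable fun i : ℕ => PowerSeries.coeff i F * z ^ i

/-- The multiplicity of `z` as a zero of `F`: the least `k` with `F^{(k)}(z) ≠ 0`
(the characteristic is zero). -/
def zeroMult (F : ℂ_[p]⟦X⟧) (z : ℂ_[p]) : ℕ :=
  sInf {k | evalAt ((PowerSeries.derivative ℂ_[p])^[k] F) z ≠ 0}

/-- The indices at which the coefficients of `F` have minimal valuation (maximal norm). -/
def minIndices (F : ℂ_[p]⟦X⟧) : Set ℕ :=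
  {n | ∀ i, ‖PowerSeries.coeff i F‖ ≤ ‖PowerSeries.coeff n F‖}

/-- The Weierstrass degree exists, i.e. the minimum of the valuations of the coefficients is
attained. -/
def HasFiniteWideg (F : ℂ_[p]⟦X⟧) : Prop := (minIndices F).Nonempty

/-- The Weierstrass degree for the open unit disc: the smallest index of minimal valuation. -/
def wideg (F : ℂ_[p]⟦X⟧) : ℕ := sInf (minIndices F)

/-- The Weierstrass degree for the closed unit disc: the largest index of minimal valuation. -/
def lwideg (F : ℂ_[p]⟦X⟧) : ℕ := sSup (minIndices F)

/-- The product of the values of `G` at the zeros of `F` in `D`, counted with multiplicity. -/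
def prodOverZeros (D : Set ℂ_[p]) (F G : ℂ_[p]⟦X⟧) : ℂ_[p] :=
  ∏ᶠ z ∈ {z | z ∈ D ∧ evalAt F z = 0}, evalAt G z ^ zeroMult F z

/-- The resultant on the open unit disc, `F_n^N ∏ G(z)` over the zeros `z` of `F` in the open disc,
with `n = wideg F`, `N = wideg G`. -/
def resO (F G : ℂ_[p]⟦X⟧) : ℂ_[p] :=
  PowerSeries.coeff (wideg F) F ^ wideg G * prodOverZeros (Metric.ball 0 1) F G

/-- The resultant on the closed unit disc, `F_m^M ∏ G(z)` over the zeros `z` of `F` in the closed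
disc, with `m = lwideg F`, `M = lwideg G`. -/
def resC (F G : ℂ_[p]⟦X⟧) : ℂ_[p] :=
  PowerSeries.coeff (lwideg F) F ^ lwideg G * prodOverZeros (Metric.closedBall 0 1) F G

/-- `φ(z) = min (v(F(z)), v(G(z)))`, with `v` normalized by `v(ϖ) = 1`. -/
def phi (ϖ : ℂ_[p]) (F G : ℂ_[p]⟦X⟧) (z : ℂ_[p]) : EReal :=
  min (val ϖ (evalAt F z)) (val ϖ (evalAt G z))

/-! ### Finite extensions `K` of `ℚ_p` inside `ℂ_p` -/

/-- The ring of integers `𝒪_K`, as the ring of elements of `K` of norm at most one. -/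
abbrev ringInt (K : IntermediateField ℚ_[p] ℂ_[p]) : ValuationSubring K :=
  (PadicComplexInt p).comap (algebraMap K ℂ_[p])

/-- The inclusion `𝒪_K → ℂ_p`. -/
def incl (K : IntermediateField ℚ_[p] ℂ_[p]) : ringInt K →+* ℂ_[p] :=
  (algebraMap K ℂ_[p]).comp (ringInt K).subtype

/-- A power series over `𝒪_K`, seen over `ℂ_p`. -/
abbrev toCp {K : IntermediateField ℚ_[p] ℂ_[p]} (F : (ringInt K)⟦X⟧) : ℂ_[p]⟦X⟧ :=
  PowerSeries.map (incl K) F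

/-- The residue degree of `K`: the degree of the residue field over its prime field. -/
def residueDeg (K : IntermediateField ℚ_[p] ℂ_[p]) : ℕ :=
  Module.finrank (⊥ : Subfield (IsLocalRing.ResidueField (ringInt K)))
    (IsLocalRing.ResidueField (ringInt K))

/-- The ramification index of `K` with uniformizer `π`: the exact power of `π` dividing `p`. -/
def ramIndex {K : IntermediateField ℚ_[p] ℂ_[p]} (π : ringInt K) : ℕ :=
  multiplicity π (p : ringInt K)

/-- `S` and `s` are the maximum and the minimum of `φ` on `D ∩ K`. -/
def IsMaxMin (K : IntermediateField ℚ_[p] ℂ_[p]) (ϖ : ℂ_[p]) (D : Set ℂ_[p]) (F G : ℂ_[p]⟦X⟧)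
    (S s : ℝ) : Prop :=
  IsGreatest (phi ϖ F G '' (D ∩ (K : Set ℂ_[p]))) (S : EReal) ∧
    IsLeast (phi ϖ F G '' (D ∩ (K : Set ℂ_[p]))) (s : EReal)

end PadicResultant

end

open PadicResultant

/-! Weierstrass preparation reduces the theorem to polynomials. On the disc `D` in question, `F = P
U` and `G = Q V` with `P`, `Q` monic over `𝒪_K`, all their roots in `D`, and `|U| = |V| = 1` on `D`.
So `φ` can be read off from `P` and `Q`, and the analytic resultant has the norm of `Res(P, Q)`, the
determinant of the Sylvester map `Φ(u, v) = P v + Q u`.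

The bound comes from comparing lattices through `Φ`. If `u` and `v` take values divisible by `π ^ t`
on `D ∩ K`, then `Φ(u, v)` takes values divisible by `π ^ (s + t)`, and by `π ^ (S + t)` at a point
`x₀` where `φ` reaches its maximum `S`. Hence `v_π(Res(P, Q))` plus the colength of the source
lattice is at least the colength of the target lattice.

The colengths come from a `π`-ordering: points `x_j` of `D ∩ K`, with `x₀` prescribed, such that
`N_j(y) = ∏_{i < j} (y - x_i)` is divisible by `π ^ a(j)` on `D ∩ K`, exactly so at `y = x_j`.
Writing `j` in base `q = p ^ f` produces such points, and a count as in Legendre's formula gives `a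
= α` on `𝒪_K` and `a = α'` on `𝔪_K`. The polynomials with values in `π ^ u` then have the basis `π ^
(u - a(j))^+ N_j`. Its colength `∑_j (u - a(j))^+` is at most `∑_{m ≤ u} min {j : a(j) ≥ m}`, that
is `B(u)` or `B'(u)`, with equality once the degree bound is large; the extra condition at `x₀` adds
`S - s`. The source thus costs at most `2B(t)`. The formal degree of `Q` is raised until the target
yields the full `B(s + t) + S - s`, which leaves the resultant unchanged because `P` is monic.

The main steps are `sum_range_tsub_eq`, `IsDigitSystem.isPiOrdering`, `exists_eq_sum_lattice`,
`pow_dvd_resultant_mul` and `IsPrepared.norm_prodOverZeros`. -/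

namespace PadicResultant

/-! ### The counting functions -/

theorem alpha_mono (p f : ℕ) : Monotone (alpha p f) := by
  intro i j hij
  unfold alpha
  calc ∑ k ∈ Finset.Icc 1 i, i / p ^ (k * f) ≤ ∑ k ∈ Finset.Icc 1 i, j / p ^ (k * f) :=
        Finset.sum_le_sum fun k _ => Nat.div_le_div_right hij
    _ ≤ _ := Finset.sum_le_sum_of_subset (Finset.Icc_subset_Icc_right hij)

theorem le_alpha_mul_pow {p f : ℕ} (hp : 0 < p) (m : ℕ) (hm : 0 < m) :
    m ≤ alpha p f (m * p ^ f) := by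
  have h : 1 ∈ Finset.Icc 1 (m * p ^ f) := by
    simp only [Finset.mem_Icc, le_refl, true_and]
    exact Nat.mul_pos hm (pow_pos hp _)
  calc m = m * p ^ f / p ^ (1 * f) := by
        rw [one_mul, Nat.mul_div_cancel _ (pow_pos hp _)]
    _ ≤ _ := Finset.single_le_sum (f := fun k => m * p ^ f / p ^ (k * f))
        (fun _ _ => Nat.zero_le _) h

theorem exists_le_alpha {p f : ℕ} (hp : 0 < p) (m : ℕ) : ∃ j, m ≤ alpha p f j := by
  rcases Nat.eq_zero_or_pos m with rfl | hm
  · exact ⟨0, Nat.zero_le _⟩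
  · exact ⟨_, le_alpha_mul_pow hp m hm⟩

/-- Double counting: `∑_{j < d} (s - a j)^+ = ∑_{m = 1}^s min d (b m)`, where `b` is the generalized
inverse of the monotone unbounded function `a`. -/
theorem sum_range_tsub_eq {a : ℕ → ℕ} (ha : Monotone a) (hu : ∀ m, ∃ j, m ≤ a j) (s d : ℕ) :
    ∑ j ∈ Finset.range d, (s - a j) = ∑ m ∈ Finset.Icc 1 s, min d (sInf {j | m ≤ a j}) := by
  have key : ∀ m j, m ≤ a j ↔ sInf {j | m ≤ a j} ≤ j := fun m j =>
    ⟨fun h => Nat.sInf_le h, fun h => (Nat.sInf_mem (s := {j | m ≤ a j}) (hu m)).trans (ha h)⟩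
  have h1 : ∀ j, s - a j = ∑ m ∈ Finset.Icc 1 s, if a j < m then 1 else 0 := by
    intro j
    rw [← Finset.card_filter]
    have : (Finset.Icc 1 s).filter (fun m => a j < m) = Finset.Icc (a j + 1) s := by
      ext m
      simp only [Finset.mem_filter, Finset.mem_Icc]
      omega
    rw [this, Nat.card_Icc]
    omega
  have h2 : ∀ m, min d (sInf {j | m ≤ a j}) = ∑ j ∈ Finset.range d, if a j < m then 1 else 0 := by
    intro m
    rw [← Finset.card_filter]
    have : (Finset.range d).filter (fun j => a j < m)
        = Finset.range (min d (sInf {j | m ≤ a j})) := by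
      ext j
      have := key m j
      simp only [Finset.mem_filter, Finset.mem_range]
      omega
    rw [this, Finset.card_range]
  simp_rw [h1, h2]
  exact Finset.sum_comm

/-- Uniform in the degree bound `d`: this controls the source lattice of the Sylvester map. -/
theorem sum_range_tsub_le {a : ℕ → ℕ} (ha : Monotone a) (hu : ∀ m, ∃ j, m ≤ a j) (s d : ℕ) :
    ∑ j ∈ Finset.range d, (s - a j) ≤ ∑ m ∈ Finset.Icc 1 s, sInf {j | m ≤ a j} := by
  rw [sum_range_tsub_eq ha hu]
  exact Finset.sum_le_sum fun _ _ => min_le_right _ _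

/-- Once `a` has reached `s`, the truncation by `d` no longer acts; this evaluates the target
lattice exactly. -/
theorem sum_range_tsub_eq_of_le {a : ℕ → ℕ} (ha : Monotone a) (hu : ∀ m, ∃ j, m ≤ a j) {s d : ℕ}
    (hd : s ≤ a d) :
    ∑ j ∈ Finset.range d, (s - a j) = ∑ m ∈ Finset.Icc 1 s, sInf {j | m ≤ a j} := by
  rw [sum_range_tsub_eq ha hu]
  refine Finset.sum_congr rfl fun m hm => min_eq_right (Nat.sInf_le ?_)
  exact (Finset.mem_Icc.mp hm).2.trans hd

/-! ### An ordering of representatives in a local domain with finite residue field -/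

section Ordering

variable {R : Type*} [CommRing R]

/-- The element `∑ rep (d_k) π ^ k` of `R` attached to the natural number with base `q` digits
`d_k`. -/
def digitPoint (q : ℕ) (rep : ℕ → R) (π : R) (n : ℕ) : R :=
  if _h : 2 ≤ q ∧ n ≠ 0 then rep (n % q) + π * digitPoint q rep π (n / q) else 0
termination_by n
decreasing_by exact Nat.div_lt_self (Nat.pos_of_ne_zero _h.2) _h.1

theorem digitPoint_zero (q : ℕ) (rep : ℕ → R) (π : R) : digitPoint q rep π 0 = 0 := by
  rw [digitPoint]; simp

theorem digitPoint_eq {q : ℕ} (hq : 2 ≤ q) {rep : ℕ → R} (h0 : rep 0 = 0) (π : R) (n : ℕ) :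
    digitPoint q rep π n = rep (n % q) + π * digitPoint q rep π (n / q) := by
  rcases eq_or_ne n 0 with rfl | hn
  · simp [digitPoint_zero, h0]
  · conv_lhs => rw [digitPoint]
    simp [hq, hn]

variable {q : ℕ} {rep : ℕ → R} {π : R}

/-- `rep` maps `{0, …, q - 1}` bijectively to `R / π`. -/
structure IsDigitSystem (q : ℕ) (rep : ℕ → R) (π : R) : Prop where
  two_le : 2 ≤ q
  rep_zero : rep 0 = 0
  inj : ∀ i < q, ∀ j < q, π ∣ rep i - rep j → i = j
  surj : ∀ x, ∃ i < q, π ∣ x - rep i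

/-- Digit points are distributed modulo powers of `π` as the natural numbers are modulo powers of
`q`: the lowest digit is determined modulo `π`, and removing it divides the difference by `π`. -/
theorem pow_dvd_digitPoint_sub_iff [IsDomain R] (hπ : π ≠ 0) (H : IsDigitSystem q rep π)
    (k i j : ℕ) :
    π ^ k ∣ digitPoint q rep π i - digitPoint q rep π j ↔ i ≡ j [MOD q ^ k] := by
  have hq : 0 < q := by have := H.two_le; omega
  induction k generalizing i j with
  | zero => simp [Nat.modEq_one]
  | succ k ih =>
    rw [digitPoint_eq H.two_le H.rep_zero π i, digitPoint_eq H.two_le H.rep_zero π j]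
    have hsplit : i ≡ j [MOD q ^ (k + 1)] ↔ i % q = j % q ∧ i / q ≡ j / q [MOD q ^ k] := by
      constructor
      · intro h
        have h1 : i % q = j % q := h.of_dvd (dvd_pow_self q (Nat.succ_ne_zero k))
        refine ⟨h1, ?_⟩
        rw [← Nat.div_add_mod i q, ← Nat.div_add_mod j q, h1] at h
        have h2 := Nat.ModEq.add_right_cancel' _ h
        rw [pow_succ'] at h2
        exact Nat.ModEq.mul_left_cancel' hq.ne' h2
      · rintro ⟨h1, h2⟩
        rw [← Nat.div_add_mod i q, ← Nat.div_add_mod j q, h1, pow_succ']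
        exact (Nat.ModEq.mul_left' q h2).add_right _
    rw [hsplit]
    have hring : ∀ a b c d : R, a + π * b - (c + π * d) = (a - c) + π * (b - d) := by
      intros; ring
    rw [hring]
    constructor
    · intro h
      have h1 : π ∣ rep (i % q) - rep (j % q) := by
        have := (dvd_pow_self π (Nat.succ_ne_zero k)).trans h
        exact (dvd_add_left (Dvd.intro _ rfl)).mp this
      have h2 := H.inj _ (Nat.mod_lt _ hq) _ (Nat.mod_lt _ hq) h1
      refine ⟨h2, (ih _ _).mp ?_⟩
      rw [h2, sub_self, zero_add, pow_succ'] at h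
      exact (mul_dvd_mul_iff_left hπ).mp h
    · rintro ⟨h1, h2⟩
      rw [h1, sub_self, zero_add, pow_succ']
      exact mul_dvd_mul_left _ ((ih _ _).mpr h2)

theorem exists_pow_dvd_sub_digitPoint (H : IsDigitSystem q rep π) (k : ℕ) (x : R) :
    ∃ r, π ^ k ∣ x - digitPoint q rep π r := by
  have hq : 0 < q := by have := H.two_le; omega
  induction k generalizing x with
  | zero => exact ⟨0, by simp⟩
  | succ k ih =>
    obtain ⟨i, hi, y, hy⟩ := H.surj x
    obtain ⟨r, z, hz⟩ := ih y
    refine ⟨i + q * r, z, ?_⟩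
    rw [digitPoint_eq H.two_le H.rep_zero, Nat.add_mul_mod_self_left, Nat.mod_eq_of_lt hi,
      Nat.add_mul_div_left _ _ hq, Nat.div_eq_of_lt hi, zero_add, pow_succ']
    linear_combination hy + π * hz

/-- The number of such exponents is at most the largest of them. Expressing divisibility through
this count turns the exponent of a product into a double sum whose order can be exchanged. -/
theorem pow_card_filter_dvd (x : R) (L : ℕ) [DecidablePred fun k => π ^ k ∣ x] :
    π ^ ((Finset.Icc 1 L).filter fun k => π ^ k ∣ x).card ∣ x := by
  set A := (Finset.Icc 1 L).filter fun k => π ^ k ∣ x with hA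
  rcases A.eq_empty_or_nonempty with h | h
  · simp [h]
  · have hm := A.max'_mem h
    have hsub : A ⊆ Finset.Icc 1 (A.max' h) := fun k hk => by
      rw [Finset.mem_Icc]
      exact ⟨(Finset.mem_Icc.mp (Finset.mem_filter.mp hk).1).1, A.le_max' k hk⟩
    have hc := Finset.card_le_card hsub
    rw [Nat.card_Icc, Nat.add_sub_cancel] at hc
    exact (pow_dvd_pow π hc).trans (Finset.mem_filter.mp hm).2

/-- As in Legendre's formula: modulo `π ^ k`, `x` agrees with some digit point of index `r`, and at
least `⌊j / q ^ k⌋` of the indices below `j` are congruent to `r` modulo `q ^ k`. -/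
theorem pow_dvd_prod_sub_digitPoint [IsDomain R] (hπ : π ≠ 0) (H : IsDigitSystem q rep π)
    (x : R) (j : ℕ) :
    π ^ (∑ k ∈ Finset.Icc 1 j, j / q ^ k)
      ∣ ∏ i ∈ Finset.range j, (x - digitPoint q rep π i) := by
  classical
  have hq : 0 < q := by have := H.two_le; omega
  have h1 : π ^ (∑ i ∈ Finset.range j,
      ((Finset.Icc 1 j).filter fun k => π ^ k ∣ x - digitPoint q rep π i).card)
      ∣ ∏ i ∈ Finset.range j, (x - digitPoint q rep π i) := by
    rw [← Finset.prod_pow_eq_pow_sum]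
    exact Finset.prod_dvd_prod_of_dvd _ _ fun i _ => pow_card_filter_dvd _ _
  refine (pow_dvd_pow π ?_).trans h1
  simp_rw [Finset.card_filter]
  rw [Finset.sum_comm]
  refine Finset.sum_le_sum fun k _ => ?_
  obtain ⟨r, hr⟩ := exists_pow_dvd_sub_digitPoint H k x
  have hiff : ∀ i, π ^ k ∣ x - digitPoint q rep π i ↔ i ≡ r [MOD q ^ k] := by
    intro i
    rw [← pow_dvd_digitPoint_sub_iff hπ H]
    have : x - digitPoint q rep π i
      = (x - digitPoint q rep π r) - (digitPoint q rep π i - digitPoint q rep π r) := by ring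
    rw [this]
    exact dvd_sub_right hr
  simp_rw [hiff]
  rw [← Finset.card_filter, ← Nat.count_eq_card_filter_range, Nat.count_modEq_card _ (pow_pos hq k)]
  exact Nat.le_add_right _ _

/-- The preceding count is sharp at the digit point `j`: exactly `⌊j / q ^ k⌋` indices below `j` are
congruent to `j` modulo `q ^ k`. -/
theorem exists_isUnit_prod_digitPoint_sub [IsDomain R] [IsLocalRing R]
    (hm : IsLocalRing.maximalIdeal R = Ideal.span {π}) (hπ : π ≠ 0)
    (H : IsDigitSystem q rep π) (j : ℕ) :
    ∃ u, IsUnit u ∧ ∏ i ∈ Finset.range j, (digitPoint q rep π j - digitPoint q rep π i)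
      = π ^ (∑ k ∈ Finset.Icc 1 j, j / q ^ k) * u := by
  classical
  have hq : 0 < q := by have := H.two_le; omega
  have h1 : ∀ i ∈ Finset.range j, ∃ u, IsUnit u ∧
      digitPoint q rep π j - digitPoint q rep π i
        = π ^ ((Finset.Icc 1 j).filter fun k => i ≡ j [MOD q ^ k]).card * u := by
    intro i hi
    rw [Finset.mem_range] at hi
    have hset : ((Finset.Icc 1 j).filter fun k => i ≡ j [MOD q ^ k])
        = (Finset.Icc 1 j).filter
          fun k => π ^ k ∣ digitPoint q rep π j - digitPoint q rep π i := by
      refine Finset.filter_congr fun k _ => ?_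
      rw [pow_dvd_digitPoint_sub_iff hπ H]
      exact ⟨Nat.ModEq.symm, Nat.ModEq.symm⟩
    obtain ⟨u, hu⟩ := pow_card_filter_dvd (digitPoint q rep π j - digitPoint q rep π i) (π := π) j
    refine ⟨u, ?_, by rw [hset]; exact hu⟩
    -- If `π` divided the cofactor, then `i ≡ j` modulo `q ^ (c + 1)`. This forces `c + 1 < q ^ (c +
    -- 1) ≤ j - i`, so all of `1, …, c + 1` lie in a set of cardinality `c`.
    by_contra hnu
    have hmem : u ∈ IsLocalRing.maximalIdeal R := (IsLocalRing.mem_maximalIdeal u).mpr hnu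
    rw [hm, Ideal.mem_span_singleton] at hmem
    rw [← hset] at hu
    set c := ((Finset.Icc 1 j).filter fun k => i ≡ j [MOD q ^ k]).card with hc
    have hd : π ^ (c + 1) ∣ digitPoint q rep π j - digitPoint q rep π i := by
      rw [hu, pow_succ]; exact mul_dvd_mul_left _ hmem
    rw [pow_dvd_digitPoint_sub_iff hπ H] at hd
    have hd' := hd.symm
    have hle : q ^ (c + 1) ≤ j - i :=
      Nat.le_of_dvd (by omega) ((Nat.modEq_iff_dvd' hi.le).mp hd')
    have hlt : c + 1 < q ^ (c + 1) := Nat.lt_pow_self H.two_le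
    have hsub : Finset.Icc 1 (c + 1) ⊆ (Finset.Icc 1 j).filter fun k => i ≡ j [MOD q ^ k] := by
      intro k hk
      rw [Finset.mem_Icc] at hk
      rw [Finset.mem_filter, Finset.mem_Icc]
      exact ⟨⟨hk.1, by omega⟩, hd'.of_dvd (pow_dvd_pow q hk.2)⟩
    have := Finset.card_le_card hsub
    rw [Nat.card_Icc, ← hc] at this
    omega
  choose! u hu hu' using h1
  refine ⟨∏ i ∈ Finset.range j, u i, ?_, ?_⟩
  · exact Finset.prod_induction u IsUnit (fun _ _ => IsUnit.mul) isUnit_one hu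
  · rw [Finset.prod_congr rfl hu', Finset.prod_mul_distrib, Finset.prod_pow_eq_pow_sum]
    congr 2
    simp_rw [Finset.card_filter]
    rw [Finset.sum_comm]
    refine Finset.sum_congr rfl fun k _ => ?_
    rw [← Finset.card_filter, ← Nat.count_eq_card_filter_range,
      Nat.count_modEq_card _ (pow_pos hq k)]
    -- The extra term of the count is present only if `j % q ^ k < j % q ^ k`, hence never.
    simp

theorem exists_isDigitSystem [IsLocalRing R] (hm : IsLocalRing.maximalIdeal R = Ideal.span {π})
    (hfin : Finite (IsLocalRing.ResidueField R)) :
    ∃ rep : ℕ → R, IsDigitSystem (Nat.card (IsLocalRing.ResidueField R)) rep π := by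
  classical
  set k := IsLocalRing.ResidueField R
  have hc : 2 ≤ Nat.card k := Finite.one_lt_card
  let e0 : Fin (Nat.card k) ≃ k := (Finite.equivFin k).symm
  let z : Fin (Nat.card k) := ⟨0, by omega⟩
  -- The swap gives the zero residue class the index `0`, so that `rep 0 = 0` is a legitimate
  -- representative.
  let e : Fin (Nat.card k) ≃ k := (Equiv.swap z (e0.symm 0)).trans e0
  have hez : e z = 0 := by simp [e]
  have hdvd : ∀ x y : R, π ∣ x - y ↔ IsLocalRing.residue R x = IsLocalRing.residue R y := by
    intro x y
    rw [← sub_eq_zero, ← map_sub, IsLocalRing.residue_eq_zero_iff, hm, Ideal.mem_span_singleton]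
  let lift : k → R := Function.surjInv (IsLocalRing.residue_surjective (R := R))
  have hlift : ∀ x, IsLocalRing.residue R (lift x) = x :=
    Function.surjInv_eq _
  let rep : ℕ → R := fun n => if h : n < Nat.card k ∧ n ≠ 0 then lift (e ⟨n, h.1⟩) else 0
  have hrep : ∀ n (h : n < Nat.card k), IsLocalRing.residue R (rep n) = e ⟨n, h⟩ := by
    intro n h
    rcases eq_or_ne n 0 with rfl | h0
    · simp only [rep, ne_eq, not_true_eq_false, and_false, dite_false, map_zero]
      exact hez.symm
    · have hr : rep n = lift (e ⟨n, h⟩) := dif_pos ⟨h, h0⟩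
      rw [hr, hlift]
  refine ⟨rep, hc, by simp [rep], ?_, ?_⟩
  · intro i hi j hj h
    rw [hdvd, hrep i hi, hrep j hj] at h
    simpa using e.injective h
  · intro x
    refine ⟨e.symm (IsLocalRing.residue R x), Fin.isLt _, ?_⟩
    rw [hdvd, hrep _ (Fin.isLt _)]
    simp

end Ordering

/-! ### Lattices of polynomials with divisible values, and the resultant -/

section Lattice

open Polynomial

variable {R : Type*} [CommRing R]

/-- The Newton polynomial `∏_{i < j} (X - x_i)`. -/
noncomputable def newtonPoly (x : ℕ → R) (j : ℕ) : R[X] := ∏ i ∈ Finset.range j, (X - C (x i))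

theorem newtonPoly_monic (x : ℕ → R) (j : ℕ) : (newtonPoly x j).Monic :=
  monic_prod_of_monic _ _ fun i _ => monic_X_sub_C (x i)

theorem newtonPoly_natDegree [Nontrivial R] (x : ℕ → R) (j : ℕ) :
    (newtonPoly x j).natDegree = j := by
  simp [newtonPoly, natDegree_prod_of_monic, monic_X_sub_C]

theorem newtonPoly_eval (x : ℕ → R) (j : ℕ) (y : R) :
    (newtonPoly x j).eval y = ∏ i ∈ Finset.range j, (y - x i) := by
  simp [newtonPoly, eval_prod]

theorem newtonPoly_eval_of_lt (x : ℕ → R) {i j : ℕ} (h : i < j) :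
    (newtonPoly x j).eval (x i) = 0 := by
  rw [newtonPoly_eval]
  exact Finset.prod_eq_zero (Finset.mem_range.mpr h) (sub_self _)

/-- There is one monic Newton polynomial in each degree, so the leading coefficient can be removed
degree by degree. -/
theorem exists_eq_sum_newtonPoly [Nontrivial R] (x : ℕ → R) (d : ℕ) (g : R[X])
    (hg : g.degree < d) :
    ∃ e : ℕ → R, g = ∑ j ∈ Finset.range d, C (e j) * newtonPoly x j := by
  induction d generalizing g with
  | zero =>
    refine ⟨0, ?_⟩
    simp only [Finset.range_zero, Finset.sum_empty]
    rw [← degree_eq_bot]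
    exact Nat.WithBot.lt_zero_iff.mp hg
  | succ d ih =>
    obtain ⟨e, he⟩ := ih (g - C (g.coeff d) * newtonPoly x d) (by
      rw [degree_lt_iff_coeff_zero] at hg ⊢
      intro m hm
      rw [coeff_sub, coeff_C_mul]
      rcases hm.eq_or_lt with rfl | hlt
      · have : (newtonPoly x d).coeff d = 1 := by
          have := (newtonPoly_monic x d).coeff_natDegree
          rwa [newtonPoly_natDegree] at this
        rw [this, mul_one, sub_self]
      · have h0 : (newtonPoly x d).coeff m = 0 :=
          coeff_eq_zero_of_natDegree_lt (by rw [newtonPoly_natDegree]; exact hlt)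
        rw [hg m hlt, h0, mul_zero, sub_zero])
    refine ⟨Function.update e d (g.coeff d), ?_⟩
    rw [Finset.sum_range_succ, Function.update_self, Finset.sum_congr rfl (g := fun j =>
      C (e j) * newtonPoly x j), ← he, sub_add_cancel]
    intro j hj
    rw [Function.update_of_ne (Finset.mem_range.mp hj).ne]

/-- Points `x_j` of `D` such that the values of the Newton polynomials on `D` are divisible by
`π ^ a j`, with equality at `x_j`. -/
structure IsPiOrdering (π : R) (D : Set R) (x : ℕ → R) (a : ℕ → ℕ) : Prop where
  mem : ∀ j, x j ∈ D
  dvd : ∀ j, ∀ y ∈ D, π ^ a j ∣ (newtonPoly x j).eval y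
  eq : ∀ j, ∃ u, IsUnit u ∧ (newtonPoly x j).eval (x j) = π ^ a j * u

/-- The exponents of an adapted basis of the polynomials whose values on `D` are divisible by
`π ^ u`, and by `π ^ S` at `x_0`. -/
def latticeExp (a : ℕ → ℕ) (S u j : ℕ) : ℕ := if j = 0 then S else u - a j

/-- Newton interpolation: at `x_j` only the terms of index at most `j` survive, so the coefficients
are determined recursively by the values, and the sharpness of the ordering at `x_j` bounds each
from below. -/
theorem exists_eq_sum_lattice [IsDomain R] {π : R} (hπ : π ≠ 0) {D : Set R} {x : ℕ → R} {a : ℕ → ℕ}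
    (H : IsPiOrdering π D x a) (S u d : ℕ) (g : R[X]) (hg : g.degree < d)
    (hu : ∀ y ∈ D, π ^ u ∣ g.eval y) (hS : π ^ S ∣ g.eval (x 0)) :
    ∃ c : ℕ → R, g = ∑ j ∈ Finset.range d, C (c j) * (C (π ^ latticeExp a S u j) *
      newtonPoly x j) := by
  obtain ⟨e, he⟩ := exists_eq_sum_newtonPoly x d g hg
  have hev : ∀ j < d, g.eval (x j) = ∑ i ∈ Finset.range j, e i * (newtonPoly x i).eval (x j)
      + e j * (newtonPoly x j).eval (x j) := by
    intro j hj
    rw [he, eval_finsetSum, ← Finset.sum_range_succ]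
    simp only [eval_mul, eval_C]
    symm
    refine Finset.sum_subset (Finset.range_subset_range.mpr hj) fun i _ hi => ?_
    rw [Finset.mem_range, not_lt] at hi
    rw [newtonPoly_eval_of_lt x (by omega), mul_zero]
  have h1 : ∀ j < d, π ^ (u - a j) ∣ e j := by
    intro j
    induction j using Nat.strong_induction_on with
    | _ j ih =>
      intro hj
      have hsum : π ^ u ∣ ∑ i ∈ Finset.range j, e i * (newtonPoly x i).eval (x j) := by
        refine Finset.dvd_sum fun i hi => ?_
        rw [Finset.mem_range] at hi
        have := mul_dvd_mul (ih i hi (hi.trans hj)) (H.dvd i (x j) (H.mem j))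
        rw [← pow_add] at this
        exact (pow_dvd_pow π (by omega)).trans this
      have hlast : π ^ u ∣ e j * (newtonPoly x j).eval (x j) := by
        rw [← dvd_add_right hsum, ← hev j hj]
        exact hu _ (H.mem j)
      obtain ⟨v, hv, hv'⟩ := H.eq j
      rw [hv', ← mul_assoc, hv.dvd_mul_right] at hlast
      rcases le_total u (a j) with h | h
      · rw [Nat.sub_eq_zero_of_le h, pow_zero]
        exact one_dvd _
      · rw [← Nat.sub_add_cancel h, pow_add] at hlast
        exact (mul_dvd_mul_iff_right (pow_ne_zero _ hπ)).mp hlast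
  have h2 : ∀ j < d, π ^ latticeExp a S u j ∣ e j := by
    intro j hj
    unfold latticeExp
    split_ifs with h0
    -- The coefficient of index `0` is the value at `x_0`, where the stronger divisibility holds.
    · subst h0
      have := hev 0 hj
      rw [Finset.range_zero, Finset.sum_empty, zero_add, newtonPoly_eval, Finset.range_zero,
        Finset.prod_empty, mul_one] at this
      rwa [← this]
    · exact h1 j hj
  choose! c hc using h2
  refine ⟨c, he.trans (Finset.sum_congr rfl fun j hj => ?_)⟩
  rw [hc j (Finset.mem_range.mp hj), C_mul]
  ring

/-- The matrix of the polynomials `π ^ b j * newtonPoly x j` in the monomial basis. -/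
noncomputable def newtonMatrix (π : R) (x : ℕ → R) (b : ℕ → ℕ) (d : ℕ) :
    Matrix (Fin d) (Fin d) R :=
  Matrix.of fun i j => (C (π ^ b j) * newtonPoly x j).coeff i

theorem det_newtonMatrix [Nontrivial R] (π : R) (x : ℕ → R) (b : ℕ → ℕ) (d : ℕ) :
    (newtonMatrix π x b d).det = π ^ ∑ j ∈ Finset.range d, b j := by
  rw [Matrix.det_of_isUpperTriangular, ← Finset.prod_pow_eq_pow_sum, ← Fin.prod_univ_eq_prod_range
    (fun j => π ^ b j)]
  · refine Finset.prod_congr rfl fun i _ => ?_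
    have := (newtonPoly_monic x (i : ℕ)).coeff_natDegree
    rw [newtonPoly_natDegree] at this
    rw [newtonMatrix, Matrix.of_apply, coeff_C_mul, this, mul_one]
  · intro i j hij
    rw [newtonMatrix, Matrix.of_apply, coeff_C_mul, coeff_eq_zero_of_natDegree_lt, mul_zero]
    rw [newtonPoly_natDegree]
    exact hij

theorem degree_C_mul_newtonPoly_lt [Nontrivial R] (r : R) (x : ℕ → R) {j d : ℕ} (hj : j < d) :
    (C r * newtonPoly x j).degree < d := by
  rw [degree_lt_iff_coeff_zero]
  intro m hm
  rw [coeff_C_mul, coeff_eq_zero_of_natDegree_lt, mul_zero]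
  rw [newtonPoly_natDegree]
  omega

/-- Multiplication by `f` and `g` maps the polynomials with values divisible by `π ^ t` to
polynomials with values divisible by `π ^ (s + t)`; comparing determinants bounds the resultant. -/
theorem pow_dvd_resultant_mul [IsDomain R] {π : R} (hπ : π ≠ 0) {D : Set R} {x : ℕ → R} {a : ℕ → ℕ}
    (H : IsPiOrdering π D x a) (f g : R[X]) {m n : ℕ} (hf : f.natDegree ≤ m)
    (hg : g.natDegree ≤ n) (S s t : ℕ)
    (hfs : ∀ y ∈ D, π ^ s ∣ f.eval y) (hgs : ∀ y ∈ D, π ^ s ∣ g.eval y)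
    (hfS : π ^ S ∣ f.eval (x 0)) (hgS : π ^ S ∣ g.eval (x 0)) :
    π ^ (∑ j ∈ Finset.range (m + n), latticeExp a (S + t) (s + t) j) ∣
      resultant f g m n *
        π ^ (∑ j ∈ Finset.range m, (t - a j) + ∑ j ∈ Finset.range n, (t - a j)) := by
  classical
  set b : ℕ → ℕ := fun j => t - a j with hb
  have hbt : ∀ j, ∀ y ∈ D, π ^ t ∣ (C (π ^ b j) * newtonPoly x j).eval y := by
    intro j y hy
    rw [eval_mul, eval_C]
    have := mul_dvd_mul (dvd_refl (π ^ b j)) (H.dvd j y hy)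
    rw [← pow_add] at this
    exact (pow_dvd_pow π (by simp only [hb]; omega)).trans this
  let B := ((degreeLT.basis R m).prod (degreeLT.basis R n))
  let w : Fin m ⊕ Fin n → (degreeLT R m × degreeLT R n) := Sum.elim
    (fun j => (⟨C (π ^ b j) * newtonPoly x j,
      mem_degreeLT.mpr (degree_C_mul_newtonPoly_lt _ _ j.isLt)⟩, 0))
    (fun j => (0, ⟨C (π ^ b j) * newtonPoly x j,
      mem_degreeLT.mpr (degree_C_mul_newtonPoly_lt _ _ j.isLt)⟩))
  -- The map `(u, v) ↦ f v + g u`; the family `w` spans the source lattice.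
  let Φ := sylvesterMap f g hf hg
  have hw : ∀ k, ∃ c : ℕ → R, ((Φ (w k) : degreeLT R (m + n)) : R[X])
      = ∑ j ∈ Finset.range (m + n), C (c j) * (C (π ^ latticeExp a (S + t) (s + t) j) *
        newtonPoly x j) := by
    intro k
    refine exists_eq_sum_lattice hπ H _ _ _ _ (mem_degreeLT.mp (Φ (w k)).2) ?_ ?_
    · intro y hy
      rcases k with j | j
      · simp only [Φ, w, Sum.elim_inl, sylvesterMap_apply_coe, Submodule.coe_zero, mul_zero,
          zero_add]
        rw [eval_mul, pow_add]
        exact mul_dvd_mul (hgs y hy) (hbt j y hy)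
      · simp only [Φ, w, Sum.elim_inr, sylvesterMap_apply_coe, Submodule.coe_zero, mul_zero,
          add_zero]
        rw [eval_mul, pow_add]
        exact mul_dvd_mul (hfs y hy) (hbt j y hy)
    · rcases k with j | j
      · simp only [Φ, w, Sum.elim_inl, sylvesterMap_apply_coe, Submodule.coe_zero, mul_zero,
          zero_add]
        rw [eval_mul, pow_add]
        exact mul_dvd_mul hgS (hbt j _ (H.mem 0))
      · simp only [Φ, w, Sum.elim_inr, sylvesterMap_apply_coe, Submodule.coe_zero, mul_zero,
          add_zero]
        rw [eval_mul, pow_add]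
        exact mul_dvd_mul hfS (hbt j _ (H.mem 0))
  choose c hc using hw
  let N : Matrix (Fin m ⊕ Fin n) (Fin m ⊕ Fin n) R := Matrix.of fun i j => B.repr (w j) i
  have hN : N = Matrix.fromBlocks (newtonMatrix π x b m) 0 0 (newtonMatrix π x b n) := by
    ext i j
    rcases i with i | i <;> rcases j with j | j <;>
      simp [N, B, w, newtonMatrix, degreeLT.basis_repr]
  have hdetN : N.det = π ^ (∑ j ∈ Finset.range m, b j + ∑ j ∈ Finset.range n, b j) := by
    rw [hN, Matrix.det_fromBlocks_zero₂₁, det_newtonMatrix, det_newtonMatrix, pow_add]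
  let Q : Matrix (Fin (m + n)) (Fin m ⊕ Fin n) R := Matrix.of fun i k => c k i
  -- The images of the source vectors, written both through the Sylvester matrix and in the adapted
  -- basis of the target.
  have hmain : (sylvester f g m n).submatrix id finSumFinEquiv * N
      = newtonMatrix π x (latticeExp a (S + t) (s + t)) (m + n) * Q := by
    ext i k
    have h1 : LinearMap.toMatrix B (degreeLT.basis R (m + n)) Φ
        = (sylvester f g m n).submatrix id finSumFinEquiv := by
      rw [toMatrix_sylvesterMap]
      rfl
    have h2 := congrFun (LinearMap.toMatrix_mulVec_repr B (degreeLT.basis R (m + n)) Φ (w k)) i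
    rw [h1] at h2
    have h3 : ((sylvester f g m n).submatrix id finSumFinEquiv * N) i k
        = ((sylvester f g m n).submatrix id finSumFinEquiv).mulVec (B.repr (w k)) i := rfl
    rw [h3, h2, degreeLT.basis_repr, hc k, finsetSum_coeff, Matrix.mul_apply,
      ← Fin.sum_univ_eq_sum_range (fun j => (C (c k j) *
        (C (π ^ latticeExp a (S + t) (s + t) j) * newtonPoly x j)).coeff i)]
    refine Finset.sum_congr rfl fun j _ => ?_
    rw [coeff_C_mul, mul_comm]
    rfl
  -- Reindexing makes all factors square over one index type, so that determinants can be taken.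
  have hA : (sylvester f g m n).submatrix finSumFinEquiv finSumFinEquiv * N
      = (newtonMatrix π x (latticeExp a (S + t) (s + t)) (m + n)).submatrix
          finSumFinEquiv finSumFinEquiv * Q.submatrix finSumFinEquiv id := by
    rw [Matrix.submatrix_mul_equiv, ← hmain]
    rfl
  have hdet := congrArg Matrix.det hA
  rw [Matrix.det_mul, Matrix.det_mul, Matrix.det_submatrix_equiv_self,
    Matrix.det_submatrix_equiv_self, det_newtonMatrix, hdetN] at hdet
  exact Dvd.intro _ hdet.symm

/-- The points `x₀ + π ^ ε c_j`, with `c_j` the digit points, form a `π`-ordering of the ideal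
generated by `π ^ ε`. -/
theorem IsDigitSystem.isPiOrdering [IsDomain R] [IsLocalRing R] {π : R} {q : ℕ} {rep : ℕ → R}
    (hm : IsLocalRing.maximalIdeal R = Ideal.span {π}) (hπ : π ≠ 0)
    (H : IsDigitSystem q rep π) (ε : ℕ) {x₀ : R} (hx₀ : π ^ ε ∣ x₀) :
    IsPiOrdering π {y | π ^ ε ∣ y} (fun j => x₀ + π ^ ε * digitPoint q rep π j)
      (fun j => ε * j + ∑ k ∈ Finset.Icc 1 j, j / q ^ k) := by
  have hprod : ∀ (z : R) (j : ℕ), ∏ i ∈ Finset.range j,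
      (x₀ + π ^ ε * z - (x₀ + π ^ ε * digitPoint q rep π i))
      = π ^ (ε * j) * ∏ i ∈ Finset.range j, (z - digitPoint q rep π i) := by
    intro z j
    have hc : π ^ (ε * j) = ∏ _i ∈ Finset.range j, π ^ ε := by
      rw [Finset.prod_const, Finset.card_range, pow_mul]
    rw [hc, ← Finset.prod_mul_distrib]
    exact Finset.prod_congr rfl fun i _ => by ring
  refine ⟨fun j => dvd_add hx₀ (Dvd.intro _ rfl), fun j y hy => ?_, fun j => ?_⟩
  · obtain ⟨z, hz⟩ := dvd_sub (show π ^ ε ∣ y from hy) hx₀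
    obtain rfl : y = x₀ + π ^ ε * z := by rw [← hz]; ring
    rw [newtonPoly_eval, hprod, pow_add]
    exact mul_dvd_mul_left _ (pow_dvd_prod_sub_digitPoint hπ H z j)
  · obtain ⟨u, hu, hu'⟩ := exists_isUnit_prod_digitPoint_sub hm hπ H j
    refine ⟨u, hu, ?_⟩
    rw [newtonPoly_eval, hprod, hu', pow_add, mul_assoc]

/-- The lower bound for the resultant in terms of the minimum `s` of the valuations of the values
on the ideal generated by `π ^ ε`, and of the values at one point `x₀`. -/
theorem pow_dvd_resultant_mul_of_isLocalRing [IsDomain R] [IsLocalRing R] {π : R}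
    (hm : IsLocalRing.maximalIdeal R = Ideal.span {π}) (hπ : π ≠ 0)
    (hfin : Finite (IsLocalRing.ResidueField R)) {a : ℕ → ℕ} (ε : ℕ)
    (ha : ∀ j, a j = ε * j + ∑ k ∈ Finset.Icc 1 j,
      j / Nat.card (IsLocalRing.ResidueField R) ^ k)
    (hmono : Monotone a) (hunb : ∀ m, ∃ j, m ≤ a j)
    (f g : R[X]) (hf : f.Monic) {S s : ℕ} (hsS : s ≤ S) (t : ℕ) {x₀ : R} (hx₀ : π ^ ε ∣ x₀)
    (hfs : ∀ y, π ^ ε ∣ y → π ^ s ∣ f.eval y) (hgs : ∀ y, π ^ ε ∣ y → π ^ s ∣ g.eval y)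
    (hfS : π ^ S ∣ f.eval x₀) (hgS : π ^ S ∣ g.eval x₀) :
    π ^ (S - s + ∑ m ∈ Finset.Icc 1 (s + t), sInf {j | m ≤ a j}) ∣
      resultant f g * π ^ (2 * ∑ m ∈ Finset.Icc 1 t, sInf {j | m ≤ a j}) := by
  obtain ⟨rep, H⟩ := exists_isDigitSystem hm hfin
  have HO := H.isPiOrdering hm hπ ε hx₀
  rw [← (funext ha : a = _)] at HO
  obtain ⟨N, hN⟩ := hunb (s + t)
  have hx0 : x₀ + π ^ ε * digitPoint (Nat.card (IsLocalRing.ResidueField R)) rep π 0 = x₀ := by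
    rw [digitPoint_zero, mul_zero, add_zero]
  -- A formal degree for `g` large enough that `a` reaches `s + t` below the total degree; the extra
  -- `1` makes room to split off the index `0`.
  set n := g.natDegree + (N + 1) with hn
  have hmain := pow_dvd_resultant_mul hπ HO f g le_rfl (n := n) (Nat.le_add_right _ _) S s t
    hfs hgs (hx0.symm ▸ hfS) (hx0.symm ▸ hgS)
  rw [hn, resultant_add_right_deg _ _ _ _ _ le_rfl, ← leadingCoeff, hf.leadingCoeff, one_pow,
    one_mul] at hmain
  have ha0 : a 0 = 0 := by rw [ha]; simp
  -- Since `a 0 = 0`, the term `j = 0` is `S + t` in place of `s + t`, whence the surplus `S - s`.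
  have hsum : ∑ j ∈ Finset.range (f.natDegree + n), latticeExp a (S + t) (s + t) j
      = S - s + ∑ m ∈ Finset.Icc 1 (s + t), sInf {j | m ≤ a j} := by
    rw [← sum_range_tsub_eq_of_le hmono hunb (d := f.natDegree + n)
      (hN.trans (hmono (by omega))), show f.natDegree + n = f.natDegree + g.natDegree + N + 1 by
      omega, Finset.sum_range_succ', Finset.sum_range_succ']
    simp only [latticeExp, Nat.add_eq_zero_iff, one_ne_zero, and_false, if_false, if_true, ha0]
    omega
  rw [← hn, hsum] at hmain
  refine hmain.trans (mul_dvd_mul_left _ (pow_dvd_pow _ ?_))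
  have h1 := sum_range_tsub_le hmono hunb t f.natDegree
  have h2 := sum_range_tsub_le hmono hunb t n
  omega

end Lattice

/-! ### The ring of integers of `K` -/

section RingInt

variable {p : ℕ} [Fact p.Prime]

theorem mem_padicComplexInt_iff (x : ℂ_[p]) : x ∈ PadicComplexInt p ↔ ‖x‖ ≤ 1 := by
  rw [PadicComplexInt, Valuation.mem_valuationSubring_iff, PadicComplex.norm_eq_norm]
  exact Valued.toNormedField.norm_le_one_iff.symm

variable {K : IntermediateField ℚ_[p] ℂ_[p]}

theorem mem_ringInt_iff (x : K) : x ∈ ringInt K ↔ ‖(x : ℂ_[p])‖ ≤ 1 :=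
  mem_padicComplexInt_iff (x : ℂ_[p])

theorem norm_incl_le (x : ringInt K) : ‖incl K x‖ ≤ 1 := (mem_ringInt_iff _).mp x.2

theorem incl_injective : Function.Injective (incl K) :=
  (algebraMap K ℂ_[p]).injective.comp Subtype.val_injective

theorem incl_eq_zero {x : ringInt K} : incl K x = 0 ↔ x = 0 :=
  map_eq_zero_iff _ incl_injective

theorem exists_incl_eq {z : ℂ_[p]} (hz : z ∈ K) (h : ‖z‖ ≤ 1) : ∃ x : ringInt K, incl K x = z :=
  ⟨⟨⟨z, hz⟩, (mem_ringInt_iff _).mpr h⟩, rfl⟩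

theorem dvd_iff_norm_le (x y : ringInt K) : x ∣ y ↔ ‖incl K y‖ ≤ ‖incl K x‖ := by
  constructor
  · rintro ⟨c, rfl⟩
    rw [map_mul, norm_mul]
    exact mul_le_of_le_one_right (norm_nonneg _) (norm_incl_le c)
  · intro h
    rcases eq_or_ne x 0 with rfl | hx
    · rw [map_zero, norm_zero, norm_le_zero_iff, incl_eq_zero] at h
      rw [h]
    · have hx' : incl K x ≠ 0 := fun h0 => hx (incl_eq_zero.mp h0)
      obtain ⟨c, hc⟩ := exists_incl_eq (K := K) (z := incl K y / incl K x)
        (K.div_mem (y : K).2 (x : K).2)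
        (by rw [norm_div]; exact div_le_one_of_le₀ h (norm_nonneg _))
      refine ⟨c, incl_injective ?_⟩
      rw [map_mul, hc, mul_div_cancel₀ _ hx']

theorem isUnit_iff_norm_eq (x : ringInt K) : IsUnit x ↔ ‖incl K x‖ = 1 := by
  rw [isUnit_iff_dvd_one, dvd_iff_norm_le, map_one, norm_one]
  exact ⟨fun h => le_antisymm (norm_incl_le x) h, fun h => h.ge⟩

theorem mem_maximalIdeal_iff_norm_lt (x : ringInt K) :
    x ∈ IsLocalRing.maximalIdeal (ringInt K) ↔ ‖incl K x‖ < 1 := by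
  rw [IsLocalRing.mem_maximalIdeal, mem_nonunits_iff, isUnit_iff_norm_eq]
  exact ⟨fun h => lt_of_le_of_ne (norm_incl_le x) h, fun h => h.ne⟩

theorem norm_prime : ‖(p : ℂ_[p])‖ = (p : ℝ)⁻¹ := by
  have h := PadicComplex.norm_extends' p (p : ℚ_[p])
  rw [Padic.norm_p] at h
  rw [← h]
  congr 1
  exact (map_natCast (algebraMap ℚ_[p] ℂ_[p]) p).symm

theorem norm_prime_lt_one : ‖(p : ℂ_[p])‖ < 1 := by
  rw [norm_prime]
  exact inv_lt_one_of_one_lt₀ (by exact_mod_cast (Fact.out : p.Prime).one_lt)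

theorem prime_ne_zero : (p : ℂ_[p]) ≠ 0 := by
  exact_mod_cast (Fact.out : p.Prime).ne_zero

theorem norm_uniformizer_lt_one {π : ringInt K}
    (hπ : IsLocalRing.maximalIdeal (ringInt K) = Ideal.span {π}) : ‖incl K π‖ < 1 := by
  rw [← mem_maximalIdeal_iff_norm_lt, hπ]
  exact Ideal.mem_span_singleton_self π

theorem norm_lt_one_iff_dvd {π : ringInt K}
    (hπ : IsLocalRing.maximalIdeal (ringInt K) = Ideal.span {π}) (x : ringInt K) :
    ‖incl K x‖ < 1 ↔ π ∣ x := by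
  rw [← mem_maximalIdeal_iff_norm_lt, hπ, Ideal.mem_span_singleton]

theorem uniformizer_ne_zero {π : ringInt K}
    (hπ : IsLocalRing.maximalIdeal (ringInt K) = Ideal.span {π}) : π ≠ 0 := by
  rintro rfl
  have h : (0 : ringInt K) ∣ (p : ringInt K) := by
    rw [← norm_lt_one_iff_dvd hπ, map_natCast]
    exact norm_prime_lt_one
  rw [zero_dvd_iff, ← incl_eq_zero, map_natCast] at h
  exact prime_ne_zero h

theorem norm_uniformizer_pos {π : ringInt K}
    (hπ : IsLocalRing.maximalIdeal (ringInt K) = Ideal.span {π}) : 0 < ‖incl K π‖ :=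
  norm_pos_iff.mpr fun h => uniformizer_ne_zero hπ (incl_eq_zero.mp h)

/-- The powers of `|π|` tend to zero, so a nonzero element has finite multiplicity, and a cofactor
not divisible by `π` has norm one. -/
theorem exists_eq_pow_mul {π : ringInt K}
    (hπ : IsLocalRing.maximalIdeal (ringInt K) = Ideal.span {π}) {x : ringInt K} (hx : x ≠ 0) :
    ∃ (k : ℕ) (u : ringInt K), IsUnit u ∧ x = π ^ k * u := by
  have hpos : 0 < ‖incl K x‖ := norm_pos_iff.mpr fun h => hx (incl_eq_zero.mp h)
  obtain ⟨n, hn⟩ := exists_pow_lt_of_lt_one hpos (norm_uniformizer_lt_one hπ)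
  have hfin : FiniteMultiplicity π x := ⟨n, fun h => by
    rw [dvd_iff_norm_le, map_pow, norm_pow] at h
    have : ‖incl K π‖ ^ (n + 1) ≤ ‖incl K π‖ ^ n :=
      pow_le_pow_of_le_one (norm_nonneg _) (norm_incl_le π) (Nat.le_succ n)
    linarith⟩
  obtain ⟨u, hu, hnd⟩ := hfin.exists_eq_pow_mul_and_not_dvd
  refine ⟨_, u, ?_, hu⟩
  rw [isUnit_iff_norm_eq]
  rw [← norm_lt_one_iff_dvd hπ, not_lt] at hnd
  exact le_antisymm (norm_incl_le u) hnd

theorem exists_norm_eq_pow {π : ringInt K}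
    (hπ : IsLocalRing.maximalIdeal (ringInt K) = Ideal.span {π}) {x : ringInt K} (hx : x ≠ 0) :
    ∃ k : ℕ, ‖incl K x‖ = ‖incl K π‖ ^ k := by
  obtain ⟨k, u, hu, rfl⟩ := exists_eq_pow_mul hπ hx
  exact ⟨k, by rw [map_mul, norm_mul, (isUnit_iff_norm_eq u).mp hu, mul_one, map_pow, norm_pow]⟩

theorem norm_prime_eq_pow {π : ringInt K}
    (hπ : IsLocalRing.maximalIdeal (ringInt K) = Ideal.span {π}) :
    ‖(p : ℂ_[p])‖ = ‖incl K π‖ ^ ramIndex π := by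
  have h0 : (p : ringInt K) ≠ 0 := fun h => prime_ne_zero (p := p) (by
    rw [← map_natCast (incl K), h, map_zero])
  obtain ⟨k, u, hu, hk⟩ := exists_eq_pow_mul hπ h0
  have hmul : ramIndex π = k := by
    refine multiplicity_eq_of_dvd_of_not_dvd (Dvd.intro _ hk.symm) fun h => ?_
    rw [hk, pow_succ, mul_dvd_mul_iff_left (pow_ne_zero _ (uniformizer_ne_zero hπ)),
      ← norm_lt_one_iff_dvd hπ, (isUnit_iff_norm_eq u).mp hu] at h
    exact lt_irrefl _ h
  rw [hmul, ← map_natCast (incl K), hk, map_mul, norm_mul, (isUnit_iff_norm_eq u).mp hu, mul_one,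
    map_pow, norm_pow]

theorem ramIndex_pos {π : ringInt K}
    (hπ : IsLocalRing.maximalIdeal (ringInt K) = Ideal.span {π}) : 0 < ramIndex π := by
  rw [Nat.pos_iff_ne_zero]
  intro h
  have := norm_prime_eq_pow hπ
  rw [h, pow_zero] at this
  exact norm_prime_lt_one.ne this

theorem properSpace_of_finiteDimensional [FiniteDimensional ℚ_[p] K] : ProperSpace K :=
  FiniteDimensional.proper ℚ_[p] K

theorem isCompact_ringInt [FiniteDimensional ℚ_[p] K] (r : ℝ) :
    IsCompact {z : ℂ_[p] | z ∈ K ∧ ‖z‖ ≤ r} := by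
  have := properSpace_of_finiteDimensional (K := K)
  have h := (isCompact_closedBall (0 : K) r).image (continuous_subtype_val)
  convert h using 1
  ext z
  simp only [Set.mem_ofPred_eq, Set.mem_image, mem_closedBall_zero_iff]
  exact ⟨fun h => ⟨⟨z, h.1⟩, h.2, rfl⟩, by rintro ⟨y, hy, rfl⟩; exact ⟨y.2, hy⟩⟩

/-- By compactness, finitely many open balls of radius one cover `𝒪_K`, and two integers in the same
ball have the same residue. -/
theorem finite_residueField [FiniteDimensional ℚ_[p] K] :
    Finite (IsLocalRing.ResidueField (ringInt K)) := by
  have hc := (isCompact_ringInt (K := K) 1).totallyBounded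
  obtain ⟨T, hT, hcov⟩ := Metric.totallyBounded_iff.mp hc 1 one_pos
  classical
  let g : ℂ_[p] → IsLocalRing.ResidueField (ringInt K) := fun y =>
    if h : ∃ x : ringInt K, dist (incl K x) y < 1 then IsLocalRing.residue _ h.choose else 0
  refine Set.finite_univ_iff.mp ((hT.image g).subset fun k _ => ?_)
  obtain ⟨x, rfl⟩ := IsLocalRing.residue_surjective k
  have hx : incl K x ∈ ⋃ y ∈ T, Metric.ball y 1 := hcov ⟨(x : K).2, norm_incl_le x⟩
  simp only [Set.mem_iUnion, Metric.mem_ball, exists_prop] at hx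
  obtain ⟨y, hy, hxy⟩ := hx
  refine ⟨y, hy, ?_⟩
  have hex : ∃ x : ringInt K, dist (incl K x) y < 1 := ⟨x, hxy⟩
  simp only [g, dif_pos hex]
  rw [← sub_eq_zero, ← map_sub, IsLocalRing.residue_eq_zero_iff, mem_maximalIdeal_iff_norm_lt,
    map_sub, ← dist_eq_norm]
  refine (dist_triangle_max _ y _).trans_lt (max_lt hex.choose_spec ?_)
  rwa [dist_comm]

theorem card_residueField [FiniteDimensional ℚ_[p] K] :
    Nat.card (IsLocalRing.ResidueField (ringInt K)) = p ^ residueDeg K := by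
  have := finite_residueField (K := K)
  have hchar : CharP (IsLocalRing.ResidueField (ringInt K)) p := by
    refine (CharP.charP_iff_prime_eq_zero (Fact.out : p.Prime)).mpr ?_
    rw [← map_natCast (IsLocalRing.residue (ringInt K)), IsLocalRing.residue_eq_zero_iff,
      mem_maximalIdeal_iff_norm_lt, map_natCast]
    exact norm_prime_lt_one
  have h := Module.natCard_eq_pow_finrank
    (K := (⊥ : Subfield (IsLocalRing.ResidueField (ringInt K))))
    (V := IsLocalRing.ResidueField (ringInt K))
  rwa [Subfield.card_bot (IsLocalRing.ResidueField (ringInt K)) p] at h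

/-- Divisibility by `π ^ n` means norm at most `|π| ^ n`, so adic limits are metric limits, which
exist because `K` is finite-dimensional over `ℚ_p`. -/
theorem isAdicComplete_ringInt {π : ringInt K}
    (hπ : IsLocalRing.maximalIdeal (ringInt K) = Ideal.span {π}) [FiniteDimensional ℚ_[p] K] :
    IsAdicComplete (IsLocalRing.maximalIdeal (ringInt K)) (ringInt K) := by
  have hmem : ∀ (n : ℕ) (x : ringInt K),
      x ∈ (IsLocalRing.maximalIdeal (ringInt K) ^ n • ⊤ : Submodule (ringInt K) (ringInt K)) ↔
        ‖incl K x‖ ≤ ‖incl K π‖ ^ n := by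
    intro n x
    rw [smul_eq_mul, Ideal.mul_top, hπ, Ideal.span_singleton_pow, Ideal.mem_span_singleton,
      dvd_iff_norm_le, map_pow, norm_pow]
  have hlim := tendsto_pow_atTop_nhds_zero_of_lt_one (norm_nonneg _) (norm_uniformizer_lt_one hπ)
  refine { haus' := fun x hx => ?_, prec' := fun f hf => ?_ }
  · rw [← incl_eq_zero, ← norm_le_zero_iff]
    refine ge_of_tendsto' hlim fun n => ?_
    have := hx n
    rwa [SModEq.zero, hmem] at this
  · have hd : ∀ {m n : ℕ}, m ≤ n → ‖incl K (f m) - incl K (f n)‖ ≤ ‖incl K π‖ ^ m := by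
      intro m n hmn
      have := hf hmn
      rwa [SModEq.sub_mem, hmem, map_sub] at this
    have hcs : CauchySeq fun n => ((f n : ringInt K) : K) := by
      refine Metric.cauchySeq_iff'.mpr fun e he => ?_
      obtain ⟨N, hN⟩ := exists_pow_lt_of_lt_one he (norm_uniformizer_lt_one hπ)
      refine ⟨N, fun n hn => ?_⟩
      rw [dist_comm, dist_eq_norm]
      exact (hd hn).trans_lt hN
    have := FiniteDimensional.complete ℚ_[p] K
    obtain ⟨l, hl⟩ := cauchySeq_tendsto_of_complete hcs
    have hl' : Filter.Tendsto (fun n => incl K (f n)) Filter.atTop (nhds (l : ℂ_[p])) :=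
      (continuous_subtype_val.tendsto l).comp hl
    have hl1 : ‖(l : ℂ_[p])‖ ≤ 1 := le_of_tendsto' hl'.norm fun n => norm_incl_le (f n)
    refine ⟨⟨l, (mem_ringInt_iff l).mpr hl1⟩, fun n => ?_⟩
    rw [SModEq.sub_mem, hmem, map_sub]
    refine le_of_tendsto (hl'.const_sub (incl K (f n))).norm ?_
    filter_upwards [Filter.eventually_ge_atTop n] with k hk
    exact hd hk

end RingInt

/-! ### Values and zeros of convergent power series -/

section Eval

open PowerSeries Filter

variable {p : ℕ} [Fact p.Prime]

/-- `F` converges at `z`. -/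
def ConvAt (F : ℂ_[p]⟦X⟧) (z : ℂ_[p]) : Prop := Summable fun i : ℕ => coeff i F * z ^ i

theorem convAt_iff_tendsto (F : ℂ_[p]⟦X⟧) (z : ℂ_[p]) :
    ConvAt F z ↔ Tendsto (fun i : ℕ => coeff i F * z ^ i) atTop (nhds 0) := by
  rw [ConvAt, NonarchimedeanAddGroup.summable_iff_tendsto_cofinite_zero, Nat.cofinite_eq_atTop]

theorem mul_term_eq_sum (F G : ℂ_[p]⟦X⟧) (z : ℂ_[p]) (n : ℕ) :
    coeff n (F * G) * z ^ n = ∑ kl ∈ Finset.HasAntidiagonal.antidiagonal n,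
      coeff kl.1 F * z ^ kl.1 * (coeff kl.2 G * z ^ kl.2) := by
  rw [coeff_mul, Finset.sum_mul]
  refine Finset.sum_congr rfl fun kl h => ?_
  rw [← Finset.HasAntidiagonal.mem_antidiagonal.mp h, pow_add]
  ring

theorem hasSum_antidiagonal_mul {R : Type*} [NormedField R] [IsUltrametricDist R]
    {f g : ℕ → R} (hf : Summable f) (hg : Summable g) :
    HasSum (fun n => ∑ kl ∈ Finset.HasAntidiagonal.antidiagonal n, f kl.1 * g kl.2)
      ((∑' i, f i) * ∑' i, g i) := by
  have : NonarchimedeanRing R :=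
    { is_nonarchimedean := NonarchimedeanAddGroup.is_nonarchimedean }
  have h := Summable.mul_of_nonarchimedean hf hg
  rw [hf.tsum_mul_tsum_eq_tsum_sum_antidiagonal hg h]
  exact (summable_sum_mul_antidiagonal_of_summable_mul h).hasSum

theorem hasSum_mul {F G : ℂ_[p]⟦X⟧} {z : ℂ_[p]} (hF : ConvAt F z) (hG : ConvAt G z) :
    HasSum (fun i : ℕ => coeff i (F * G) * z ^ i) (evalAt F z * evalAt G z) := by
  have h := hasSum_antidiagonal_mul (R := ℂ_[p]) hF hG
  rwa [← (funext fun n => mul_term_eq_sum F G z n : (fun i : ℕ => coeff i (F * G) * z ^ i) = _)]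
    at h

theorem ConvAt.mul {F G : ℂ_[p]⟦X⟧} {z : ℂ_[p]} (hF : ConvAt F z) (hG : ConvAt G z) :
    ConvAt (F * G) z :=
  (hasSum_mul hF hG).summable

theorem evalAt_mul {F G : ℂ_[p]⟦X⟧} {z : ℂ_[p]} (hF : ConvAt F z) (hG : ConvAt G z) :
    evalAt (F * G) z = evalAt F z * evalAt G z :=
  (hasSum_mul hF hG).tsum_eq

theorem ConvAt.add {F G : ℂ_[p]⟦X⟧} {z : ℂ_[p]} (hF : ConvAt F z) (hG : ConvAt G z) :
    ConvAt (F + G) z := by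
  unfold ConvAt
  simp_rw [map_add, add_mul]
  exact Summable.add hF hG

theorem evalAt_add {F G : ℂ_[p]⟦X⟧} {z : ℂ_[p]} (hF : ConvAt F z) (hG : ConvAt G z) :
    evalAt (F + G) z = evalAt F z + evalAt G z := by
  unfold evalAt
  simp_rw [map_add, add_mul]
  exact Summable.tsum_add hF hG

theorem hasSum_coe (P : Polynomial ℂ_[p]) (z : ℂ_[p]) :
    HasSum (fun i : ℕ => coeff i (P : ℂ_[p]⟦X⟧) * z ^ i) (P.eval z) := by
  rw [Polynomial.eval_eq_sum_range]
  simp_rw [Polynomial.coeff_coe]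
  refine hasSum_sum_of_ne_finset_zero fun i hi => ?_
  rw [Finset.mem_range, not_lt] at hi
  rw [Polynomial.coeff_eq_zero_of_natDegree_lt (by omega), zero_mul]

theorem convAt_coe (P : Polynomial ℂ_[p]) (z : ℂ_[p]) : ConvAt (P : ℂ_[p]⟦X⟧) z :=
  (hasSum_coe P z).summable

theorem evalAt_coe (P : Polynomial ℂ_[p]) (z : ℂ_[p]) : evalAt (P : ℂ_[p]⟦X⟧) z = P.eval z :=
  (hasSum_coe P z).tsum_eq

/-- Differentiation multiplies coefficients by natural numbers, whose norm is at most one. -/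
theorem ConvAt.derivative {F : ℂ_[p]⟦X⟧} {z : ℂ_[p]} (hF : ConvAt F z) :
    ConvAt (derivative ℂ_[p] F) z := by
  rw [convAt_iff_tendsto] at *
  rcases eq_or_ne z 0 with rfl | hz
  · refine tendsto_const_nhds.congr' ?_
    filter_upwards [eventually_ge_atTop 1] with i hi
    rw [zero_pow (by omega), mul_zero]
  · have h1 : Tendsto (fun i : ℕ => coeff (i + 1) F * z ^ (i + 1)) atTop (nhds 0) :=
      hF.comp (tendsto_add_atTop_nat 1)
    have h2 : Tendsto (fun i : ℕ => ‖coeff (i + 1) F * z ^ (i + 1)‖ * ‖z‖⁻¹) atTop (nhds 0) := by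
      simpa using h1.norm.mul_const ‖z‖⁻¹
    refine squeeze_zero_norm (fun i => ?_) h2
    have hnat : ‖((i : ℂ_[p]) + 1)‖ ≤ 1 := by
      have := IsUltrametricDist.norm_natCast_le_one ℂ_[p] (i + 1)
      rwa [Nat.cast_add, Nat.cast_one] at this
    have hz' : 0 < ‖z‖ := norm_pos_iff.mpr hz
    rw [coeff_derivative, norm_mul, norm_mul, norm_mul, norm_pow, norm_pow, pow_succ,
      ← mul_assoc ‖coeff (i + 1) F‖, mul_inv_cancel_right₀ hz'.ne']
    exact mul_le_mul_of_nonneg_right (mul_le_of_le_one_right (norm_nonneg _) hnat)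
      (pow_nonneg (norm_nonneg _) _)

/-- The derivative of `(X - z) ^ (k + 1) V` is `(X - z) ^ k` times a series with value `(k + 1)
V(z)` at `z`, which is nonzero in characteristic zero; induction lowers the exponent. -/
theorem zeroMult_of_eq_pow_mul (z : ℂ_[p]) (k : ℕ) (V : ℂ_[p]⟦X⟧) (hV : ConvAt V z)
    (hVz : evalAt V z ≠ 0) :
    zeroMult ((((Polynomial.X - Polynomial.C z) ^ k : Polynomial ℂ_[p]) : ℂ_[p]⟦X⟧) * V) z = k := by
  have key : ∀ (k : ℕ) (V : ℂ_[p]⟦X⟧), ConvAt V z → evalAt V z ≠ 0 → ∀ j ≤ k,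
      (evalAt ((derivative ℂ_[p])^[j]
        ((((Polynomial.X - Polynomial.C z) ^ k : Polynomial ℂ_[p]) : ℂ_[p]⟦X⟧) * V)) z ≠ 0
          ↔ j = k) := by
    intro k
    induction k with
    | zero =>
      intro V hV hVz j hj
      obtain rfl : j = 0 := by omega
      simpa using hVz
    | succ k ih =>
      intro V hV hVz j hj
      rcases j with _ | j
      · rw [Function.iterate_zero, id, evalAt_mul (convAt_coe _ _) hV, evalAt_coe]
        simp
      · set L : Polynomial ℂ_[p] := Polynomial.X - Polynomial.C z with hL
        have hd : derivative ℂ_[p] (((L ^ (k + 1) : Polynomial ℂ_[p]) : ℂ_[p]⟦X⟧) * V)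
            = ((L ^ k : Polynomial ℂ_[p]) : ℂ_[p]⟦X⟧) *
              (((Polynomial.C ((k : ℂ_[p]) + 1) : Polynomial ℂ_[p]) : ℂ_[p]⟦X⟧) * V
                + (L : ℂ_[p]⟦X⟧) * derivative ℂ_[p] V) := by
          rw [Derivation.leibniz, derivative_coe, Polynomial.derivative_pow, hL,
            Polynomial.derivative_X_sub_C, ← hL]
          simp only [smul_eq_mul, mul_one, Polynomial.coe_mul, Polynomial.coe_pow, pow_succ,
            Nat.add_sub_cancel, Nat.cast_add, Nat.cast_one]
          ring
        have hc1 := (convAt_coe (Polynomial.C ((k : ℂ_[p]) + 1)) z).mul hV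
        have hc2 := (convAt_coe L z).mul hV.derivative
        rw [Function.iterate_succ_apply, hd, ih _ (hc1.add hc2) ?_ j (by omega)]
        · omega
        · rw [evalAt_add hc1 hc2, evalAt_mul (convAt_coe _ _) hV,
            evalAt_mul (convAt_coe _ _) hV.derivative, evalAt_coe, evalAt_coe]
          simp only [hL, Polynomial.eval_C, Polynomial.eval_sub, Polynomial.eval_X, sub_self,
            zero_mul, add_zero]
          exact mul_ne_zero (by exact_mod_cast Nat.succ_ne_zero k) hVz
  unfold zeroMult
  refine le_antisymm (Nat.sInf_le ((key k V hV hVz k le_rfl).mpr rfl)) ?_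
  by_contra! hlt
  have hne : {j | evalAt ((derivative ℂ_[p])^[j]
      ((((Polynomial.X - Polynomial.C z) ^ k : Polynomial ℂ_[p]) : ℂ_[p]⟦X⟧) * V)) z
        ≠ 0}.Nonempty :=
    ⟨k, (key k V hV hVz k le_rfl).mpr rfl⟩
  exact hlt.ne ((key k V hV hVz _ hlt.le).mp (Nat.sInf_mem hne))

theorem zeroMult_coe_mul {P : Polynomial ℂ_[p]} (hP : P ≠ 0) {U : ℂ_[p]⟦X⟧} {z : ℂ_[p]}
    (hU : ConvAt U z) (hUz : evalAt U z ≠ 0) :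
    zeroMult ((P : ℂ_[p]⟦X⟧) * U) z = P.rootMultiplicity z := by
  have hfac := P.pow_mul_divByMonic_rootMultiplicity_eq z
  have hne := Polynomial.eval_divByMonic_pow_rootMultiplicity_ne_zero z hP
  set k := P.rootMultiplicity z
  set W := P /ₘ (Polynomial.X - Polynomial.C z) ^ k
  rw [← hfac, Polynomial.coe_mul, mul_assoc]
  refine zeroMult_of_eq_pow_mul z k _ ((convAt_coe _ _).mul hU) ?_
  rw [evalAt_mul (convAt_coe _ _) hU, evalAt_coe]
  exact mul_ne_zero hne hUz

/-- If `F = P U` with `U` without zeros on `D` and all roots of `P` in `D`, then the zeros of `F` in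
`D` are the roots of `P`, with the same multiplicities. -/
theorem prodOverZeros_eq {D : Set ℂ_[p]} {P : Polynomial ℂ_[p]} (hP : P ≠ 0) {U : ℂ_[p]⟦X⟧}
    (hU : ∀ z ∈ D, ConvAt U z) (hUz : ∀ z ∈ D, evalAt U z ≠ 0) (hD : ∀ z ∈ P.roots, z ∈ D)
    (G : ℂ_[p]⟦X⟧) :
    prodOverZeros D ((P : ℂ_[p]⟦X⟧) * U) G = (P.roots.map (evalAt G)).prod := by
  classical
  unfold prodOverZeros
  have hset : {z | z ∈ D ∧ evalAt ((P : ℂ_[p]⟦X⟧) * U) z = 0} = ↑P.roots.toFinset := by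
    ext z
    simp only [Set.mem_ofPred_eq, Finset.mem_coe, Multiset.mem_toFinset]
    constructor
    · rintro ⟨hz, h0⟩
      rw [evalAt_mul (convAt_coe _ _) (hU z hz), evalAt_coe] at h0
      exact (Polynomial.mem_roots hP).mpr ((mul_eq_zero.mp h0).resolve_right (hUz z hz))
    · intro hz
      refine ⟨hD z hz, ?_⟩
      rw [evalAt_mul (convAt_coe _ _) (hU z (hD z hz)), evalAt_coe,
        (Polynomial.isRoot_of_mem_roots hz), zero_mul]
  rw [hset, finprod_mem_coe_finset, Finset.prod_multiset_map_count]
  refine Finset.prod_congr rfl fun z hz => ?_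
  have hzD := hD z (Multiset.mem_toFinset.mp hz)
  rw [zeroMult_coe_mul hP (hU z hzD) (hUz z hzD), Polynomial.count_roots]

/-- A power series with unit constant term and small other terms at `z` has a value of norm one. -/
theorem norm_evalAt_eq_one {U : ℂ_[p]⟦X⟧} {z : ℂ_[p]} (hU : ConvAt U z)
    (h0 : ‖coeff 0 U‖ = 1) {c : ℝ} (hc0 : 0 ≤ c) (hc : c < 1)
    (h : ∀ i, ‖coeff (i + 1) U * z ^ (i + 1)‖ ≤ c) : ‖evalAt U z‖ = 1 := by
  have hs : evalAt U z = coeff 0 U * z ^ 0 + ∑' i : ℕ, coeff (i + 1) U * z ^ (i + 1) :=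
    hU.tsum_eq_zero_add
  rw [pow_zero, mul_one] at hs
  have ht : ‖∑' i : ℕ, coeff (i + 1) U * z ^ (i + 1)‖ ≤ c :=
    IsUltrametricDist.norm_tsum_le_of_forall_le_of_nonneg hc0 h
  have hlt := ht.trans_lt hc
  rw [hs, IsUltrametricDist.norm_add_eq_max_of_norm_ne_norm (h0 ▸ hlt.ne'), h0,
    max_eq_left hlt.le]

end Eval

/-! ### Weierstrass preparation for restricted power series -/

section Restricted

open PowerSeries

variable {R : Type*} [CommRing R]

theorem powerSeries_C_dvd_iff (a : R) (F : R⟦X⟧) : C a ∣ F ↔ ∀ i, a ∣ coeff i F := by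
  constructor
  · rintro ⟨G, rfl⟩ i
    rw [coeff_C_mul]
    exact Dvd.intro _ rfl
  · intro h
    choose g hg using h
    exact ⟨mk g, by ext i; rw [coeff_C_mul, coeff_mk, hg]⟩

/-- The coefficients tend to zero `π`-adically. -/
def IsRestrictedAt (π : R) (F : R⟦X⟧) : Prop := ∀ k, ∃ d, ∀ i, d ≤ i → π ^ k ∣ coeff i F

/-- `F = P U` modulo `π ^ (k + 1)` with `P` monic of degree `m` and `U` congruent to `u`. -/
structure IsApproxFactorization (π : R) (F : R⟦X⟧) (m : ℕ) (u : R) (k : ℕ)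
    (x : Polynomial R × Polynomial R) : Prop where
  monic : x.1.Monic
  natDegree_eq : x.1.natDegree = m
  dvd_sub : Polynomial.C π ∣ x.2 - Polynomial.C u
  dvd : C (π ^ (k + 1)) ∣ F - (x.1 : R⟦X⟧) * (x.2 : R⟦X⟧)

/-- A Hensel step: division of the error by the monic `P` distributes it between the two factors,
the remainder going to `P` so that its degree is kept. -/
theorem IsApproxFactorization.exists_succ [IsDomain R] {π : R} (hπ : π ≠ 0) {F : R⟦X⟧}
    (hF : IsRestrictedAt π F) {m : ℕ} {u : R} (hu : IsUnit u) {k : ℕ}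
    {x : Polynomial R × Polynomial R} (hx : IsApproxFactorization π F m u k x) :
    ∃ y, IsApproxFactorization π F m u (k + 1) y ∧
      Polynomial.C (π ^ (k + 1)) ∣ y.1 - x.1 ∧ Polynomial.C (π ^ (k + 1)) ∣ y.2 - x.2 := by
  obtain ⟨P, U⟩ := x
  obtain ⟨hPm, hPd, ⟨W, hW⟩, E, hE⟩ := hx
  simp only at hPm hPd hW hE
  obtain ⟨v, hv⟩ := hu.exists_left_inv
  obtain ⟨d₀, hd₀⟩ := hF (k + 2)
  -- Beyond `d` the product `P U` has no coefficients and those of `F` are divisible by `π ^ (k +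
  -- 2)`, so modulo `π` the error `E` is a polynomial.
  set d := max d₀ ((P * U).natDegree + 1)
  have hE2 : C π ∣ E - ((trunc d E : Polynomial R) : R⟦X⟧) := by
    rw [powerSeries_C_dvd_iff]
    intro i
    rw [map_sub, Polynomial.coeff_coe, coeff_trunc]
    split_ifs with hi
    · simp
    · rw [not_lt] at hi
      have h1 := congrArg (coeff i) hE
      rw [map_sub, ← Polynomial.coe_mul, Polynomial.coeff_coe,
        Polynomial.coeff_eq_zero_of_natDegree_lt
          (lt_of_lt_of_le (Nat.lt_succ_self _) ((le_max_right _ _).trans hi)), sub_zero,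
        coeff_C_mul] at h1
      have h2 := hd₀ i ((le_max_left _ _).trans hi)
      rw [h1, pow_succ] at h2
      rw [sub_zero]
      exact (mul_dvd_mul_iff_left (pow_ne_zero _ hπ)).mp h2
  obtain ⟨E₂, hE2⟩ := hE2
  have hdiv := Polynomial.modByMonic_add_div (trunc d E) P
  set Q := trunc d E /ₘ P
  set r := trunc d E %ₘ P with hr
  have hrdeg : r.degree < P.degree := Polynomial.degree_modByMonic_lt _ hPm
  have hrdeg' : (Polynomial.C (π ^ (k + 1) * v) * r).degree < P.degree := by
    refine lt_of_le_of_lt ?_ hrdeg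
    rw [← Polynomial.smul_eq_C_mul]
    exact Polynomial.degree_smul_le _ _
  -- With `E ≡ r + P Q` modulo `π` and `v U ≡ 1` modulo `π`, the added terms `π ^ (k + 1) (v r U + P
  -- Q)` cancel the error to the next order.
  refine ⟨(P + Polynomial.C (π ^ (k + 1) * v) * r, U + Polynomial.C (π ^ (k + 1)) * Q),
    ⟨hPm.add_of_left hrdeg', ?_, ?_, ?_⟩, ?_, ?_⟩
  · rw [Polynomial.natDegree_add_eq_left_of_degree_lt hrdeg', hPd]
  · refine ⟨W + Polynomial.C (π ^ k) * Q, ?_⟩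
    simp only [pow_succ, map_mul, map_pow]
    linear_combination hW
  · refine ⟨E₂ - C v * (r : R⟦X⟧) * (W : R⟦X⟧) - C (π ^ k * v) * (r : R⟦X⟧) * (Q : R⟦X⟧), ?_⟩
    have h1 := congrArg (fun g : Polynomial R => (g : R⟦X⟧)) hdiv
    have h2 := congrArg (fun g : Polynomial R => (g : R⟦X⟧)) hW
    have h3 := congrArg (C : R →+* R⟦X⟧) hv
    simp only [Polynomial.coe_add, Polynomial.coe_mul, Polynomial.coe_sub, Polynomial.coe_C,
      Polynomial.coe_pow, map_mul, map_one, map_pow, pow_succ] at h1 h2 h3 hE hE2 ⊢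
    linear_combination hE + C π ^ k * C π * hE2 - C π ^ k * C π * h1
      - C π ^ k * C π * C v * (r : R⟦X⟧) * h2 - C π ^ k * C π * (r : R⟦X⟧) * h3
  · exact ⟨Polynomial.C v * r, by simp only [map_mul]; ring⟩
  · exact ⟨Q, by ring⟩

theorem exists_pow_dvd_sub_of_isAdicComplete {π : R} [IsAdicComplete (Ideal.span {π}) R]
    (f : ℕ → R) (hf : ∀ k, π ^ (k + 1) ∣ f (k + 1) - f k) :
    ∃ l, ∀ k, π ^ k ∣ l - f k := by
  have hmem : ∀ (n : ℕ) (x y : R),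
      x ≡ y [SMOD (Ideal.span {π} ^ n • ⊤ : Submodule R R)] ↔ π ^ n ∣ x - y := by
    intro n x y
    rw [SModEq.sub_mem, smul_eq_mul, Ideal.mul_top, Ideal.span_singleton_pow,
      Ideal.mem_span_singleton]
  have hcauchy : ∀ {m n : ℕ}, m ≤ n → π ^ m ∣ f m - f n := by
    intro m n hmn
    induction n, hmn using Nat.le_induction with
    | base => simp
    | succ n hn ih =>
      have : f m - f (n + 1) = (f m - f n) - (f (n + 1) - f n) := by ring
      rw [this]
      exact dvd_sub ih ((pow_dvd_pow π (by omega)).trans (hf n))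
  obtain ⟨l, hl⟩ := IsPrecomplete.prec (I := Ideal.span {π}) inferInstance (f := f)
    fun h => (hmem _ _ _).mpr (hcauchy h)
  refine ⟨l, fun k => ?_⟩
  rw [← neg_sub, dvd_neg]
  exact (hmem _ _ _).mp (hl k)

theorem eq_zero_of_forall_pow_dvd {π : R} [IsAdicComplete (Ideal.span {π}) R] (x : R)
    (h : ∀ k, π ^ k ∣ x) : x = 0 := by
  refine IsHausdorff.haus (I := Ideal.span {π}) inferInstance x fun n => ?_
  rw [SModEq.zero, smul_eq_mul, Ideal.mul_top, Ideal.span_singleton_pow, Ideal.mem_span_singleton]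
  exact h n

/-- **Weierstrass preparation** for restricted power series: if `F_m` is a unit and `π` divides the
coefficients of higher index, then `F = P U` with `P` monic and `U` a restricted power series
congruent to a unit constant. -/
theorem exists_restricted_factorization [IsDomain R] {π : R} (hπ : π ≠ 0)
    [IsAdicComplete (Ideal.span {π}) R] {F : R⟦X⟧} (hF : IsRestrictedAt π F) {m : ℕ}
    (hm : IsUnit (coeff m F)) (hgt : ∀ i, m < i → π ∣ coeff i F) :
    ∃ (P : Polynomial R) (U : R⟦X⟧), P.Monic ∧ F = (P : R⟦X⟧) * U ∧ IsRestrictedAt π U ∧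
      π ∣ coeff 0 U - coeff m F ∧ ∀ i, π ∣ coeff (i + 1) U := by
  set u := coeff m F with hu
  obtain ⟨v, hv⟩ := hm.exists_left_inv
  have hcm : (Polynomial.C v * trunc (m + 1) F).coeff m = 1 := by
    rw [Polynomial.coeff_C_mul, coeff_trunc, if_pos (Nat.lt_succ_self m), hv]
  have hdle : (Polynomial.C v * trunc (m + 1) F).natDegree ≤ m :=
    (Polynomial.natDegree_C_mul_le _ _).trans (Nat.lt_succ_iff.mp (natDegree_trunc_lt F m))
  -- Initial approximation: the truncation of `F` at degree `m`, made monic, times the constant `u`.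
  have h0 : IsApproxFactorization π F m u 0
      (Polynomial.C v * trunc (m + 1) F, Polynomial.C u) := by
    refine ⟨Polynomial.monic_of_natDegree_le_of_coeff_eq_one m hdle hcm,
      Polynomial.natDegree_eq_of_le_of_coeff_ne_zero hdle (by rw [hcm]; exact one_ne_zero),
      by simp, ?_⟩
    rw [powerSeries_C_dvd_iff]
    intro i
    have : ((Polynomial.C v * trunc (m + 1) F : Polynomial R) : R⟦X⟧)
        * ((Polynomial.C u : Polynomial R) : R⟦X⟧) = ((trunc (m + 1) F : Polynomial R) : R⟦X⟧) := by
      rw [← Polynomial.coe_mul, mul_right_comm, ← Polynomial.C_mul, hv, Polynomial.C_1, one_mul]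
    simp only [this, map_sub, Polynomial.coeff_coe, coeff_trunc, zero_add, pow_one]
    split_ifs with hi
    · simp
    · rw [sub_zero]
      exact hgt i (by omega)
  let step : ∀ k, {x // IsApproxFactorization π F m u k x} →
      {x // IsApproxFactorization π F m u (k + 1) x} := fun k x =>
    ⟨(x.2.exists_succ hπ hF hm).choose, (x.2.exists_succ hπ hF hm).choose_spec.1⟩
  let s : ∀ k, {x // IsApproxFactorization π F m u k x} := fun k => Nat.rec ⟨_, h0⟩ step k
  have hs1 : ∀ k, Polynomial.C (π ^ (k + 1)) ∣ (s (k + 1)).1.1 - (s k).1.1 := fun k =>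
    ((s k).2.exists_succ hπ hF hm).choose_spec.2.1
  have hs2 : ∀ k, Polynomial.C (π ^ (k + 1)) ∣ (s (k + 1)).1.2 - (s k).1.2 := fun k =>
    ((s k).2.exists_succ hπ hF hm).choose_spec.2.2
  have hlim1 : ∀ i, ∃ l, ∀ k, π ^ k ∣ l - (s k).1.1.coeff i := fun i =>
    exists_pow_dvd_sub_of_isAdicComplete _ fun k => by
      rw [← Polynomial.coeff_sub]
      exact (Polynomial.C_dvd_iff_dvd_coeff _ _).mp (hs1 k) i
  have hlim2 : ∀ i, ∃ l, ∀ k, π ^ k ∣ l - (s k).1.2.coeff i := fun i =>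
    exists_pow_dvd_sub_of_isAdicComplete _ fun k => by
      rw [← Polynomial.coeff_sub]
      exact (Polynomial.C_dvd_iff_dvd_coeff _ _).mp (hs2 k) i
  choose P hP using hlim1
  choose U hU using hlim2
  have hPm : P m = 1 := by
    rw [← sub_eq_zero]
    refine eq_zero_of_forall_pow_dvd (π := π) _ fun k => ?_
    have h1 := (s k).2.monic.coeff_natDegree
    rw [(s k).2.natDegree_eq] at h1
    rw [← h1]
    exact hP m k
  have hPgt : ∀ i, m < i → P i = 0 := by
    intro i hi
    refine eq_zero_of_forall_pow_dvd (π := π) _ fun k => ?_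
    have h1 : (s k).1.1.coeff i = 0 :=
      Polynomial.coeff_eq_zero_of_natDegree_lt (by rw [(s k).2.natDegree_eq]; exact hi)
    have := hP i k
    rwa [h1, sub_zero] at this
  have hcoe : ((trunc (m + 1) (mk P) : Polynomial R) : R⟦X⟧) = mk P := by
    ext i
    rw [Polynomial.coeff_coe, coeff_trunc, coeff_mk]
    split_ifs with hi
    · rfl
    · exact (hPgt i (by omega)).symm
  have hUc : ∀ i, π ∣ U i - (Polynomial.C u).coeff i := by
    intro i
    have h1 := hU i 1
    have h2 := (Polynomial.C_dvd_iff_dvd_coeff _ _).mp (s 1).2.dvd_sub i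
    rw [Polynomial.coeff_sub] at h2
    rw [pow_one] at h1
    have := dvd_add h1 h2
    rwa [sub_add_sub_cancel] at this
  refine ⟨trunc (m + 1) (mk P), mk U, ?_, ?_, ?_, ?_, ?_⟩
  · refine Polynomial.monic_of_natDegree_le_of_coeff_eq_one m
      (Nat.lt_succ_iff.mp (natDegree_trunc_lt _ m)) ?_
    rw [coeff_trunc, if_pos (Nat.lt_succ_self m), coeff_mk, hPm]
  · rw [hcoe, ← sub_eq_zero]
    ext i
    refine eq_zero_of_forall_pow_dvd (π := π) _ fun k => ?_
    refine (powerSeries_C_dvd_iff _ _).mp ?_ i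
    have h1 : C (π ^ k) ∣ mk P - ((s k).1.1 : R⟦X⟧) := by
      rw [powerSeries_C_dvd_iff]
      intro i
      rw [map_sub, coeff_mk, Polynomial.coeff_coe]
      exact hP i k
    have h2 : C (π ^ k) ∣ mk U - ((s k).1.2 : R⟦X⟧) := by
      rw [powerSeries_C_dvd_iff]
      intro i
      rw [map_sub, coeff_mk, Polynomial.coeff_coe]
      exact hU i k
    have h3 : C (π ^ k) ∣ F - ((s k).1.1 : R⟦X⟧) * ((s k).1.2 : R⟦X⟧) := by
      refine dvd_trans ?_ (s k).2.dvd
      rw [pow_succ, map_mul]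
      exact Dvd.intro _ rfl
    have heq : F - mk P * mk U = (F - ((s k).1.1 : R⟦X⟧) * ((s k).1.2 : R⟦X⟧))
        - (mk P - ((s k).1.1 : R⟦X⟧)) * ((s k).1.2 : R⟦X⟧)
        - mk P * (mk U - ((s k).1.2 : R⟦X⟧)) := by ring
    rw [heq]
    exact dvd_sub (dvd_sub h3 (h1.mul_right _)) (h2.mul_left _)
  · intro k
    -- `U` agrees modulo `π ^ k` with the `k`-th approximation, which is a polynomial.
    refine ⟨(s k).1.2.natDegree + 1, fun i hi => ?_⟩
    have := hU i k
    rwa [Polynomial.coeff_eq_zero_of_natDegree_lt (by omega), sub_zero,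
      ← coeff_mk (R := R) i U] at this
  · have := hUc 0
    rwa [Polynomial.coeff_C_zero, ← coeff_mk (R := R) 0 U] at this
  · intro i
    have := hUc (i + 1)
    rwa [Polynomial.coeff_C_succ, sub_zero, ← coeff_mk (R := R) (i + 1) U] at this

end Restricted

/-! ### Preparation of power series over the ring of integers -/

section Prepared

open Filter

variable {p : ℕ} [Fact p.Prime] {K : IntermediateField ℚ_[p] ℂ_[p]}

/-- `F = P U` with `P` monic over `𝒪_K`, all roots of `P` in `D`, and `|U| = 1` on `D`. -/
structure IsPrepared (D : Set ℂ_[p]) (F : ℂ_[p]⟦X⟧) (P : Polynomial (ringInt K))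
    (U : ℂ_[p]⟦X⟧) : Prop where
  monic : P.Monic
  eq_mul : F = ((P.map (incl K) : Polynomial ℂ_[p]) : ℂ_[p]⟦X⟧) * U
  convAt : ∀ z ∈ D, ConvAt U z
  norm_eq : ∀ z ∈ D, ‖evalAt U z‖ = 1
  roots : ∀ z ∈ (P.map (incl K)).roots, z ∈ D

theorem IsPrepared.norm_evalAt {D : Set ℂ_[p]} {F U : ℂ_[p]⟦X⟧} {P : Polynomial (ringInt K)}
    (H : IsPrepared D F P U) {z : ℂ_[p]} (hz : z ∈ D) :
    ‖evalAt F z‖ = ‖(P.map (incl K)).eval z‖ := by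
  rw [H.eq_mul, evalAt_mul (convAt_coe _ _) (H.convAt z hz), norm_mul, H.norm_eq z hz, mul_one,
    evalAt_coe]

/-- `P` splits over `ℂ_p`, so `Res(P, Q)` is the product of the values of `Q` at the roots of `P`;
there `G` and `Q` have equal norm. -/
theorem IsPrepared.norm_prodOverZeros {D : Set ℂ_[p]} {F G U V : ℂ_[p]⟦X⟧}
    {P Q : Polynomial (ringInt K)} (HF : IsPrepared D F P U) (HG : IsPrepared D G Q V) :
    ‖prodOverZeros D F G‖ = ‖incl K (Polynomial.resultant P Q)‖ := by
  have hPm : (P.map (incl K)).Monic := HF.monic.map _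
  have h1 : prodOverZeros D F G = ((P.map (incl K)).roots.map (evalAt G)).prod := by
    rw [HF.eq_mul]
    exact prodOverZeros_eq hPm.ne_zero HF.convAt
      (fun z hz h => by simpa [h] using HF.norm_eq z hz) HF.roots G
  have h2 := Polynomial.resultant_eq_prod_eval (P.map (incl K)) (Q.map (incl K)) Q.natDegree
    Polynomial.natDegree_map_le (IsAlgClosed.splits _)
  rw [hPm.leadingCoeff, one_pow, one_mul, HF.monic.natDegree_map, Polynomial.resultant_map_map]
    at h2
  rw [h1, h2]
  have h3 : ∀ s : Multiset ℂ_[p], (∀ z ∈ s, z ∈ D) →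
      ‖(s.map (evalAt G)).prod‖ = ‖(s.map (Q.map (incl K)).eval).prod‖ := by
    intro s
    induction s using Multiset.induction_on with
    | empty => simp
    | cons a s ih =>
      intro hs
      rw [Multiset.map_cons, Multiset.map_cons, Multiset.prod_cons, Multiset.prod_cons, norm_mul,
        norm_mul, ih fun z hz => hs z (Multiset.mem_cons_of_mem hz),
        HG.norm_evalAt (hs a (Multiset.mem_cons_self a s))]
  exact h3 _ HF.roots

/-- At a root the leading term is minus the sum of the others, so by the ultrametric inequality one
of these is at least as large. This locates the roots of the prepared polynomials. -/
theorem exists_norm_pow_le_of_root {P : Polynomial ℂ_[p]} (hP : P.Monic) {z : ℂ_[p]}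
    (hz : z ∈ P.roots) : ∃ i < P.natDegree, ‖z‖ ^ P.natDegree ≤ ‖P.coeff i‖ * ‖z‖ ^ i := by
  have h0 : P.eval z = 0 := Polynomial.isRoot_of_mem_roots hz
  have hn : P.natDegree ≠ 0 := by
    intro h
    rw [Polynomial.eq_one_of_monic_natDegree_zero hP h] at hz
    simp at hz
  rw [Polynomial.eval_eq_sum_range, Finset.sum_range_succ, hP.coeff_natDegree, one_mul] at h0
  obtain ⟨i, hi, hle⟩ := IsUltrametricDist.exists_norm_finsetSum_le_of_nonempty
    (Finset.nonempty_range_iff.mpr hn) fun i => P.coeff i * z ^ i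
  refine ⟨i, Finset.mem_range.mp hi, ?_⟩
  rw [eq_neg_of_add_eq_zero_left h0, norm_neg, norm_pow, norm_mul, norm_pow] at hle
  exact hle

theorem toCp_coe (P : Polynomial (ringInt K)) :
    toCp (P : (ringInt K)⟦X⟧) = ((P.map (incl K) : Polynomial ℂ_[p]) : ℂ_[p]⟦X⟧) :=
  (Polynomial.polynomial_map_coe).symm

theorem coeff_toCp (F : (ringInt K)⟦X⟧) (i : ℕ) :
    PowerSeries.coeff i (toCp F) = incl K (PowerSeries.coeff i F) :=
  PowerSeries.coeff_map _ _ _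

theorem exists_isPrepared_ball [FiniteDimensional ℚ_[p] K] {π : ringInt K}
    (hπ : IsLocalRing.maximalIdeal (ringInt K) = Ideal.span {π}) (F : (ringInt K)⟦X⟧) {n : ℕ}
    (hn : IsUnit (PowerSeries.coeff n F)) :
    ∃ (P : Polynomial (ringInt K)) (U : ℂ_[p]⟦X⟧),
      IsPrepared (Metric.ball 0 1) (toCp F) P U := by
  have := isAdicComplete_ringInt hπ
  have hne : F.map (IsLocalRing.residue (ringInt K)) ≠ 0 := by
    intro h
    have h1 := congrArg (PowerSeries.coeff n) h
    rw [PowerSeries.coeff_map, map_zero, IsLocalRing.residue_eq_zero_iff,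
      IsLocalRing.mem_maximalIdeal] at h1
    exact h1 hn
  obtain ⟨P, U, hPU⟩ := PowerSeries.exists_isWeierstrassFactorization hne
  have hterm : ∀ (z : ℂ_[p]) (i : ℕ),
      ‖PowerSeries.coeff i (toCp U) * z ^ i‖ ≤ ‖z‖ ^ i := by
    intro z i
    rw [coeff_toCp, norm_mul, norm_pow]
    exact mul_le_of_le_one_left (pow_nonneg (norm_nonneg _) _) (norm_incl_le _)
  have hconv : ∀ z ∈ Metric.ball (0 : ℂ_[p]) 1, ConvAt (toCp U) z := by
    intro z hz
    rw [mem_ball_zero_iff] at hz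
    rw [convAt_iff_tendsto]
    exact squeeze_zero_norm (hterm z) (tendsto_pow_atTop_nhds_zero_of_lt_one (norm_nonneg _) hz)
  refine ⟨P, toCp U, hPU.isDistinguishedAt.monic, ?_, hconv, ?_, ?_⟩
  · rw [← toCp_coe, ← map_mul, ← hPU.eq_mul]
  · intro z hz
    have hc := hconv z hz
    rw [mem_ball_zero_iff] at hz
    refine norm_evalAt_eq_one hc ?_ (norm_nonneg z) hz fun i => (hterm z _).trans ?_
    · rw [coeff_toCp, ← isUnit_iff_norm_eq]
      have := PowerSeries.isUnit_constantCoeff _ hPU.isUnit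
      rwa [← PowerSeries.coeff_zero_eq_constantCoeff_apply] at this
    · exact pow_le_of_le_one (norm_nonneg _) hz.le (Nat.succ_ne_zero i)
  · intro z hz
    rw [mem_ball_zero_iff]
    -- The lower coefficients of a distinguished polynomial have norm below one, so at `|z| ≥ 1` no
    -- lower term can balance the leading one.
    by_contra! hge
    obtain ⟨i, hi, hle⟩ := exists_norm_pow_le_of_root (hPU.isDistinguishedAt.monic.map _) hz
    rw [hPU.isDistinguishedAt.monic.natDegree_map] at hi hle
    rw [Polynomial.coeff_map] at hle
    have h1 := (mem_maximalIdeal_iff_norm_lt _).mp (hPU.isDistinguishedAt.mem hi)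
    have hpos : 0 < ‖z‖ ^ i := pow_pos (one_pos.trans_le hge) i
    have h2 : ‖incl K (P.coeff i)‖ * ‖z‖ ^ i < ‖z‖ ^ i := mul_lt_of_lt_one_left hpos h1
    exact absurd (hle.trans_lt h2) (not_lt.mpr (pow_le_pow_right₀ hge hi.le))

theorem isRestrictedAt_iff_tendsto {π : ringInt K}
    (hπ : IsLocalRing.maximalIdeal (ringInt K) = Ideal.span {π}) (F : (ringInt K)⟦X⟧) :
    IsRestrictedAt π F ↔ Tendsto (fun i => PowerSeries.coeff i (toCp F)) atTop (nhds 0) := by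
  have hiff : ∀ k i, π ^ k ∣ PowerSeries.coeff i F ↔
      ‖PowerSeries.coeff i (toCp F)‖ ≤ ‖incl K π‖ ^ k := by
    intro k i
    rw [dvd_iff_norm_le, map_pow, norm_pow, coeff_toCp]
  constructor
  · intro h
    rw [Metric.tendsto_atTop]
    intro e he
    obtain ⟨k, hk⟩ := exists_pow_lt_of_lt_one he (norm_uniformizer_lt_one hπ)
    obtain ⟨d, hd⟩ := h k
    refine ⟨d, fun i hi => ?_⟩
    rw [dist_zero_right]
    exact ((hiff k i).mp (hd i hi)).trans_lt hk
  · intro h k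
    obtain ⟨d, hd⟩ := Metric.tendsto_atTop.mp h _ (pow_pos (norm_uniformizer_pos hπ) k)
    refine ⟨d, fun i hi => (hiff k i).mpr ?_⟩
    have := hd i hi
    rw [dist_zero_right] at this
    exact this.le

/-- A unit coefficient makes the maximal norm equal to one. -/
theorem mem_minIndices_iff {F : (ringInt K)⟦X⟧} {n : ℕ} (hn : IsUnit (PowerSeries.coeff n F))
    (i : ℕ) : i ∈ minIndices (toCp F) ↔ IsUnit (PowerSeries.coeff i F) := by
  rw [isUnit_iff_norm_eq] at *
  simp only [minIndices, Set.mem_ofPred_eq, coeff_toCp]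
  constructor
  · intro h
    exact le_antisymm (norm_incl_le _) (hn ▸ h n)
  · intro h j
    rw [h]
    exact norm_incl_le _

theorem tendsto_coeff_of_convergesOn {F : ℂ_[p]⟦X⟧}
    (hF : ConvergesOn F (Metric.closedBall 0 1)) :
    Tendsto (fun i => PowerSeries.coeff i F) atTop (nhds 0) := by
  have h := (convAt_iff_tendsto F 1).mp (hF 1 (by simp))
  simpa using h

/-- Coefficients tending to zero leave only finitely many units, so the supremum defining `lwideg`
is attained rather than being a default value. -/
theorem lwideg_spec {π : ringInt K}
    (hπ : IsLocalRing.maximalIdeal (ringInt K) = Ideal.span {π}) {F : (ringInt K)⟦X⟧} {n : ℕ}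
    (hn : IsUnit (PowerSeries.coeff n F)) (hF : IsRestrictedAt π F) :
    IsUnit (PowerSeries.coeff (lwideg (toCp F)) F) ∧
      ∀ i, lwideg (toCp F) < i → π ∣ PowerSeries.coeff i F := by
  obtain ⟨d, hd⟩ := hF 1
  have hbdd : BddAbove (minIndices (toCp F)) := by
    refine ⟨d, fun i hi => ?_⟩
    by_contra! hlt
    rw [mem_minIndices_iff hn, isUnit_iff_norm_eq] at hi
    have := hd i hlt.le
    rw [pow_one, ← norm_lt_one_iff_dvd hπ, hi] at this
    exact lt_irrefl _ this
  refine ⟨(mem_minIndices_iff hn _).mp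
    (Nat.sSup_mem ⟨n, (mem_minIndices_iff hn n).mpr hn⟩ hbdd), fun i hi => ?_⟩
  rw [← norm_lt_one_iff_dvd hπ, ← mem_maximalIdeal_iff_norm_lt, IsLocalRing.mem_maximalIdeal,
    mem_nonunits_iff, ← mem_minIndices_iff hn]
  exact fun h => hi.not_ge (le_csSup hbdd h)

theorem exists_isPrepared_closedBall [FiniteDimensional ℚ_[p] K] {π : ringInt K}
    (hπ : IsLocalRing.maximalIdeal (ringInt K) = Ideal.span {π}) (F : (ringInt K)⟦X⟧) {n : ℕ}
    (hn : IsUnit (PowerSeries.coeff n F)) (hF : IsRestrictedAt π F) :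
    ∃ (P : Polynomial (ringInt K)) (U : ℂ_[p]⟦X⟧),
      IsPrepared (Metric.closedBall 0 1) (toCp F) P U := by
  have : IsAdicComplete (Ideal.span {π}) (ringInt K) := hπ ▸ isAdicComplete_ringInt hπ
  obtain ⟨hm, hgt⟩ := lwideg_spec hπ hn hF
  obtain ⟨P, U, hP, hFPU, hU, hU0, hU1⟩ :=
    exists_restricted_factorization (uniformizer_ne_zero hπ) hF hm hgt
  have hle : ∀ (z : ℂ_[p]), ‖z‖ ≤ 1 → ∀ i : ℕ,
      ‖PowerSeries.coeff i (toCp U) * z ^ i‖ ≤ ‖PowerSeries.coeff i (toCp U)‖ := by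
    intro z hz i
    rw [norm_mul, norm_pow]
    exact mul_le_of_le_one_right (norm_nonneg _) (pow_le_one₀ (norm_nonneg _) hz)
  have hconv : ∀ z ∈ Metric.closedBall (0 : ℂ_[p]) 1, ConvAt (toCp U) z := by
    intro z hz
    rw [mem_closedBall_zero_iff] at hz
    rw [convAt_iff_tendsto]
    have h1 := ((isRestrictedAt_iff_tendsto hπ U).mp hU).norm
    rw [norm_zero] at h1
    exact squeeze_zero_norm (hle z hz) h1
  refine ⟨P, toCp U, hP, ?_, hconv, ?_, ?_⟩
  · rw [← toCp_coe, ← map_mul, ← hFPU]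
  · intro z hz
    have hc := hconv z hz
    rw [mem_closedBall_zero_iff] at hz
    refine norm_evalAt_eq_one hc ?_ (norm_nonneg _) (norm_uniformizer_lt_one hπ) fun i =>
      (hle z hz _).trans ?_
    · rw [coeff_toCp, ← isUnit_iff_norm_eq]
      by_contra hnu
      rw [← mem_nonunits_iff, ← IsLocalRing.mem_maximalIdeal, hπ, Ideal.mem_span_singleton] at hnu
      have h1 := (dvd_sub_right hnu).mp hU0
      rw [← norm_lt_one_iff_dvd hπ, (isUnit_iff_norm_eq _).mp hm] at h1
      exact lt_irrefl _ h1
    · rw [coeff_toCp, ← dvd_iff_norm_le]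
      exact hU1 i
  · intro z hz
    rw [mem_closedBall_zero_iff]
    by_contra! hgt
    obtain ⟨i, hi, hle⟩ := exists_norm_pow_le_of_root (hP.map _) hz
    rw [hP.natDegree_map] at hi hle
    rw [Polynomial.coeff_map] at hle
    have h2 : ‖incl K (P.coeff i)‖ * ‖z‖ ^ i ≤ ‖z‖ ^ i :=
      mul_le_of_le_one_left (pow_nonneg (norm_nonneg _) _) (norm_incl_le _)
    exact absurd (hle.trans h2) (not_le.mpr (pow_lt_pow_right₀ hgt hi))

end Prepared

/-! ### Valuations -/

section Valuations

variable {p : ℕ} [Fact p.Prime]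

theorem val_le_val {ϖ : ℂ_[p]} (h0 : 0 < ‖ϖ‖) (h1 : ‖ϖ‖ < 1) {x y : ℂ_[p]} (h : ‖x‖ ≤ ‖y‖) :
    val ϖ y ≤ val ϖ x := by
  unfold val
  split_ifs with hy hx hx
  · exact le_rfl
  · rw [hy, norm_zero, norm_le_zero_iff] at h
    exact absurd h hx
  · exact le_top
  · rw [EReal.coe_le_coe_iff]
    exact div_le_div_of_nonpos_of_le (Real.log_nonpos h0.le h1.le)
      (Real.log_le_log (norm_pos_iff.mpr hx) h)

theorem val_eq_of_norm_eq {ϖ x : ℂ_[p]} {r : ℝ} (hr0 : 0 < r) (hr1 : r < 1) {e k : ℕ}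
    (hϖ : ‖ϖ‖ = r ^ e) (hx : ‖x‖ = r ^ k) : val ϖ x = ((k / e : ℝ) : EReal) := by
  have hx0 : x ≠ 0 := norm_pos_iff.mp (hx ▸ pow_pos hr0 k)
  rw [val, if_neg hx0, hx, hϖ, Real.log_pow, Real.log_pow,
    mul_div_mul_right _ _ (Real.log_neg hr0 hr1).ne]

/-- The exponent `e` covers both normalizations: `1` for `v_π`, the ramification index for `v_p`. -/
theorem phi_eq_of_max_norm_eq {ϖ : ℂ_[p]} {F G : ℂ_[p]⟦X⟧} {z : ℂ_[p]} {r : ℝ} (hr0 : 0 < r)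
    (hr1 : r < 1) {e k : ℕ} (he : 0 < e) (hϖ : ‖ϖ‖ = r ^ e)
    (h : max ‖evalAt F z‖ ‖evalAt G z‖ = r ^ k) : phi ϖ F G z = ((k / e : ℝ) : EReal) := by
  have h0 : 0 < ‖ϖ‖ := hϖ ▸ pow_pos hr0 e
  have h1 : ‖ϖ‖ < 1 := hϖ ▸ pow_lt_one₀ hr0.le hr1 he.ne'
  unfold phi
  rcases le_total ‖evalAt F z‖ ‖evalAt G z‖ with hle | hle
  · rw [max_eq_right hle] at h
    rw [min_eq_right (val_le_val h0 h1 hle), val_eq_of_norm_eq hr0 hr1 hϖ h]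
  · rw [max_eq_left hle] at h
    rw [min_eq_left (val_le_val h0 h1 hle), val_eq_of_norm_eq hr0 hr1 hϖ h]

end Valuations

/-! ### Extreme values of `φ` and the bound on the two discs -/

section Main

variable {p : ℕ} [Fact p.Prime] {K : IntermediateField ℚ_[p] ℂ_[p]}

/-- The extreme values of `φ` on `D ∩ K`, in terms of the polynomials `P` and `Q`. -/
theorem exists_extreme_points [FiniteDimensional ℚ_[p] K] {π : ringInt K}
    (hπ : IsLocalRing.maximalIdeal (ringInt K) = Ideal.span {π}) {D : Set ℂ_[p]} (ε : ℕ)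
    (hD : D ∩ (K : Set ℂ_[p]) = {z | z ∈ K ∧ ‖z‖ ≤ ‖incl K π‖ ^ ε})
    (P Q : Polynomial (ringInt K))
    (hPQ : ∀ y : ringInt K, π ^ ε ∣ y → ¬ (P.eval y = 0 ∧ Q.eval y = 0)) :
    ∃ (S s : ℕ) (y₁ y₂ : ringInt K), π ^ ε ∣ y₁ ∧ π ^ ε ∣ y₂ ∧
      max ‖incl K (P.eval y₁)‖ ‖incl K (Q.eval y₁)‖ = ‖incl K π‖ ^ S ∧
      max ‖incl K (P.eval y₂)‖ ‖incl K (Q.eval y₂)‖ = ‖incl K π‖ ^ s ∧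
      ∀ y, π ^ ε ∣ y → ∃ k, s ≤ k ∧ k ≤ S ∧
        max ‖incl K (P.eval y)‖ ‖incl K (Q.eval y)‖ = ‖incl K π‖ ^ k := by
  have hr0 := norm_uniformizer_pos hπ
  have hr1 := norm_uniformizer_lt_one hπ
  have hk : ∀ y : ringInt K, π ^ ε ∣ y → ∃ k : ℕ,
      max ‖incl K (P.eval y)‖ ‖incl K (Q.eval y)‖ = ‖incl K π‖ ^ k := by
    intro y hy
    have hne := hPQ y hy
    rcases le_total ‖incl K (P.eval y)‖ ‖incl K (Q.eval y)‖ with h | h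
    · rw [max_eq_right h]
      refine exists_norm_eq_pow hπ fun h0 => hne ⟨?_, h0⟩
      rw [h0, map_zero, norm_zero, norm_le_zero_iff, incl_eq_zero] at h
      exact h
    · rw [max_eq_left h]
      refine exists_norm_eq_pow hπ fun h0 => hne ⟨h0, ?_⟩
      rw [h0, map_zero, norm_zero, norm_le_zero_iff, incl_eq_zero] at h
      exact h
  have hdvd : ∀ y : ringInt K, π ^ ε ∣ y ↔ incl K y ∈ D ∩ (K : Set ℂ_[p]) := by
    intro y
    rw [hD, dvd_iff_norm_le, map_pow, norm_pow]
    exact ⟨fun h => ⟨(y : K).2, h⟩, fun h => h.2⟩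
  have hc : IsCompact (D ∩ (K : Set ℂ_[p])) := hD ▸ isCompact_ringInt _
  have hcont : ContinuousOn (fun z => max ‖(P.map (incl K)).eval z‖ ‖(Q.map (incl K)).eval z‖)
      (D ∩ (K : Set ℂ_[p])) :=
    ((P.map (incl K)).continuous.norm.max (Q.map (incl K)).continuous.norm).continuousOn
  have hne : (D ∩ (K : Set ℂ_[p])).Nonempty := ⟨incl K 0, (hdvd 0).mp (dvd_zero _)⟩
  have hlift : ∀ z ∈ D ∩ (K : Set ℂ_[p]), ∃ y : ringInt K, incl K y = z := fun z hz => by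
    have h := hD ▸ hz
    exact exists_incl_eq h.1 (h.2.trans (pow_le_one₀ hr0.le hr1.le))
  -- The order is reversed: the smallest norm gives the maximum `S` of `φ`, the largest norm the
  -- minimum `s`.
  obtain ⟨z₁, hz₁, hmin⟩ := hc.exists_isMinOn hne hcont
  obtain ⟨z₂, hz₂, hmax⟩ := hc.exists_isMaxOn hne hcont
  obtain ⟨y₁, rfl⟩ := hlift z₁ hz₁
  obtain ⟨y₂, rfl⟩ := hlift z₂ hz₂
  obtain ⟨S, hS⟩ := hk y₁ ((hdvd y₁).mpr hz₁)
  obtain ⟨s, hs⟩ := hk y₂ ((hdvd y₂).mpr hz₂)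
  refine ⟨S, s, y₁, y₂, (hdvd y₁).mpr hz₁, (hdvd y₂).mpr hz₂, hS, hs, fun y hy => ?_⟩
  obtain ⟨k, hk⟩ := hk y hy
  have h1 := hmin ((hdvd y).mp hy)
  have h2 := hmax ((hdvd y).mp hy)
  simp only [Set.mem_ofPred_eq, Polynomial.eval_map_apply, hk, hS, hs] at h1 h2
  exact ⟨k, (pow_le_pow_iff_right_of_lt_one₀ hr0 hr1).mp h2,
    (pow_le_pow_iff_right_of_lt_one₀ hr0 hr1).mp h1, hk⟩

/-- The bound for prepared series on the ideal `π ^ ε 𝒪_K`, for a valuation with `v(π) = 1 / e`. -/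
theorem exists_isMaxMin_and_bound [FiniteDimensional ℚ_[p] K] {π : ringInt K}
    (hπ : IsLocalRing.maximalIdeal (ringInt K) = Ideal.span {π}) {D : Set ℂ_[p]} (ε : ℕ)
    (hD : D ∩ (K : Set ℂ_[p]) = {z | z ∈ K ∧ ‖z‖ ≤ ‖incl K π‖ ^ ε})
    {a : ℕ → ℕ} (ha : ∀ j, a j = ε * j + alpha p (residueDeg K) j)
    {F G U V : ℂ_[p]⟦X⟧} {P Q : Polynomial (ringInt K)} (HF : IsPrepared D F P U)
    (HG : IsPrepared D G Q V)
    (hFG : ∀ z ∈ D ∩ (K : Set ℂ_[p]), ¬ (evalAt F z = 0 ∧ evalAt G z = 0))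
    {ρ : ℂ_[p]} (hρ : ‖ρ‖ = ‖prodOverZeros D F G‖) :
    ∃ S s : ℕ, ∀ (ϖ : ℂ_[p]) (e : ℕ), 0 < e → ‖ϖ‖ = ‖incl K π‖ ^ e →
      IsMaxMin K ϖ D F G (S / e) (s / e) ∧
      ∀ t : ℕ, val ϖ ρ - ((S / e : ℝ) : EReal) ≥
        ((1 / e * (((∑ m ∈ Finset.Icc 1 (s + t), sInf {j | m ≤ a j} : ℕ) : ℝ)
          - 2 * ((∑ m ∈ Finset.Icc 1 t, sInf {j | m ≤ a j} : ℕ) : ℝ) - s) : ℝ) : EReal) := by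
  have hr0 := norm_uniformizer_pos hπ
  have hr1 := norm_uniformizer_lt_one hπ
  have hdvd : ∀ y : ringInt K, π ^ ε ∣ y ↔ incl K y ∈ D ∩ (K : Set ℂ_[p]) := by
    intro y
    rw [hD, dvd_iff_norm_le, map_pow, norm_pow]
    exact ⟨fun h => ⟨(y : K).2, h⟩, fun h => h.2⟩
  have hevF : ∀ y : ringInt K, π ^ ε ∣ y → ‖evalAt F (incl K y)‖ = ‖incl K (P.eval y)‖ := by
    intro y hy
    rw [HF.norm_evalAt ((hdvd y).mp hy).1, Polynomial.eval_map_apply]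
  have hevG : ∀ y : ringInt K, π ^ ε ∣ y → ‖evalAt G (incl K y)‖ = ‖incl K (Q.eval y)‖ := by
    intro y hy
    rw [HG.norm_evalAt ((hdvd y).mp hy).1, Polynomial.eval_map_apply]
  have hPQ : ∀ y : ringInt K, π ^ ε ∣ y → ¬ (P.eval y = 0 ∧ Q.eval y = 0) := by
    rintro y hy ⟨h1, h2⟩
    refine hFG _ ((hdvd y).mp hy) ⟨?_, ?_⟩
    · rw [← norm_eq_zero, hevF y hy, h1, map_zero, norm_zero]
    · rw [← norm_eq_zero, hevG y hy, h2, map_zero, norm_zero]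
  obtain ⟨S, s, y₁, y₂, hy₁, hy₂, hS, hs, hall⟩ := exists_extreme_points hπ ε hD P Q hPQ
  refine ⟨S, s, fun ϖ e he hϖ => ⟨?_, fun t => ?_⟩⟩
  · have hphi : ∀ (y : ringInt K) (k : ℕ), π ^ ε ∣ y →
        max ‖incl K (P.eval y)‖ ‖incl K (Q.eval y)‖ = ‖incl K π‖ ^ k →
        phi ϖ F G (incl K y) = ((k / e : ℝ) : EReal) := by
      intro y k hy hk
      exact phi_eq_of_max_norm_eq hr0 hr1 he hϖ (by rw [hevF y hy, hevG y hy, hk])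
    have hbd : ∀ w ∈ phi ϖ F G '' (D ∩ (K : Set ℂ_[p])), ∃ k : ℕ, s ≤ k ∧ k ≤ S ∧
        w = ((k / e : ℝ) : EReal) := by
      rintro w ⟨z, hz, rfl⟩
      have h := hD ▸ hz
      obtain ⟨y, rfl⟩ := exists_incl_eq h.1 (h.2.trans (pow_le_one₀ hr0.le hr1.le))
      obtain ⟨k, hk1, hk2, hk⟩ := hall y ((hdvd y).mpr hz)
      exact ⟨k, hk1, hk2, hphi y k ((hdvd y).mpr hz) hk⟩
    have hmono : ∀ {k l : ℕ}, k ≤ l → ((k / e : ℝ) : EReal) ≤ ((l / e : ℝ) : EReal) := by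
      intro k l hkl
      rw [EReal.coe_le_coe_iff]
      exact div_le_div_of_nonneg_right (by exact_mod_cast hkl) (Nat.cast_nonneg e)
    refine ⟨⟨⟨_, (hdvd y₁).mp hy₁, hphi y₁ S hy₁ hS⟩, ?_⟩,
      ⟨⟨_, (hdvd y₂).mp hy₂, hphi y₂ s hy₂ hs⟩, ?_⟩⟩
    · intro w hw
      obtain ⟨k, -, hk, rfl⟩ := hbd w hw
      exact hmono hk
    · intro w hw
      obtain ⟨k, hk, -, rfl⟩ := hbd w hw
      exact hmono hk
  · have hnorm : ‖ρ‖ = ‖incl K (Polynomial.resultant P Q)‖ := by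
      rw [hρ, HF.norm_prodOverZeros HG]
    -- The resultant may vanish through a common zero outside `K`; its valuation is then infinite
    -- and the bound trivial.
    rcases eq_or_ne ρ 0 with h0 | h0
    · rw [h0, val, if_pos rfl, EReal.top_sub_coe]
      exact le_top
    · have hres : Polynomial.resultant P Q ≠ 0 := by
        intro h
        rw [h, map_zero, norm_zero, norm_eq_zero] at hnorm
        exact h0 hnorm
      obtain ⟨r, hr⟩ := exists_norm_eq_pow hπ hres
      have hle : ∀ {k : ℕ} {x y : ringInt K},
          max ‖incl K x‖ ‖incl K y‖ ≤ ‖incl K π‖ ^ k → π ^ k ∣ x ∧ π ^ k ∣ y := by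
        intro k x y h
        rw [dvd_iff_norm_le, dvd_iff_norm_le, map_pow, norm_pow]
        exact max_le_iff.mp h
      have hsmall : ∀ y, π ^ ε ∣ y → π ^ s ∣ P.eval y ∧ π ^ s ∣ Q.eval y := by
        intro y hy
        obtain ⟨k, hk, -, h⟩ := hall y hy
        exact hle (h.le.trans (pow_le_pow_of_le_one hr0.le hr1.le hk))
      have hsS : s ≤ S := by
        obtain ⟨k, h1, h2, -⟩ := hall y₁ hy₁
        exact h1.trans h2
      have hmono : Monotone a := by
        intro i j hij
        rw [ha, ha]
        exact add_le_add (Nat.mul_le_mul_left ε hij) (alpha_mono _ _ hij)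
      have hunb : ∀ m, ∃ j, m ≤ a j := by
        intro m
        obtain ⟨j, hj⟩ := exists_le_alpha (f := residueDeg K) (Fact.out : p.Prime).pos m
        exact ⟨j, by rw [ha]; omega⟩
      have hcard : ∀ j, a j = ε * j + ∑ k ∈ Finset.Icc 1 j,
          j / Nat.card (IsLocalRing.ResidueField (ringInt K)) ^ k := by
        intro j
        rw [ha, alpha, card_residueField]
        simp_rw [← pow_mul, mul_comm (residueDeg K)]
      -- The ordering is started at `y₁`, where `φ` attains its maximum.
      have hmain := pow_dvd_resultant_mul_of_isLocalRing hπ (uniformizer_ne_zero hπ)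
        finite_residueField ε hcard hmono hunb P Q HF.monic hsS t hy₁
        (fun y hy => (hsmall y hy).1) (fun y hy => (hsmall y hy).2) (hle hS.le).1 (hle hS.le).2
      rw [dvd_iff_norm_le, map_mul, norm_mul, hr, map_pow, map_pow, norm_pow, norm_pow, ← pow_add,
        pow_le_pow_iff_right_of_lt_one₀ hr0 hr1] at hmain
      rw [val_eq_of_norm_eq hr0 hr1 hϖ (hnorm.trans hr), ← EReal.coe_sub, ge_iff_le,
        EReal.coe_le_coe_iff, ← sub_div, one_div_mul_eq_div]
      refine div_le_div_of_nonneg_right ?_ (Nat.cast_nonneg e)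
      -- Moving `s` across removes the truncated subtraction `S - s`, legitimate since `s ≤ S`.
      have h1 : S + ∑ m ∈ Finset.Icc 1 (s + t), sInf {j | m ≤ a j}
          ≤ r + 2 * ∑ m ∈ Finset.Icc 1 t, sInf {j | m ≤ a j} + s := by omega
      have h2 : ((S + ∑ m ∈ Finset.Icc 1 (s + t), sInf {j | m ≤ a j} : ℕ) : ℝ)
          ≤ ((r + 2 * ∑ m ∈ Finset.Icc 1 t, sInf {j | m ≤ a j} + s : ℕ) : ℝ) := by
        exact_mod_cast h1
      rw [Nat.cast_add, Nat.cast_add, Nat.cast_add, Nat.cast_mul] at h2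
      push_cast at h2 ⊢
      linarith

/-- The valuation is discrete on `K`, so norm below one already means norm at most `|π|`; hence `ε =
1` for the open disc. -/
theorem ball_inter_eq {π : ringInt K}
    (hπ : IsLocalRing.maximalIdeal (ringInt K) = Ideal.span {π}) :
    Metric.ball (0 : ℂ_[p]) 1 ∩ (K : Set ℂ_[p]) = {z | z ∈ K ∧ ‖z‖ ≤ ‖incl K π‖ ^ 1} := by
  ext z
  simp only [Set.mem_inter_iff, mem_ball_zero_iff, SetLike.mem_coe, Set.mem_ofPred_eq, pow_one]
  constructor
  · rintro ⟨h1, h2⟩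
    obtain ⟨y, rfl⟩ := exists_incl_eq h2 h1.le
    rw [norm_lt_one_iff_dvd hπ, dvd_iff_norm_le] at h1
    exact ⟨h2, h1⟩
  · rintro ⟨h1, h2⟩
    exact ⟨h2.trans_lt (norm_uniformizer_lt_one hπ), h1⟩

theorem closedBall_inter_eq (π : ringInt K) :
    Metric.closedBall (0 : ℂ_[p]) 1 ∩ (K : Set ℂ_[p])
      = {z | z ∈ K ∧ ‖z‖ ≤ ‖incl K π‖ ^ 0} := by
  ext z
  simp only [Set.mem_inter_iff, mem_closedBall_zero_iff, SetLike.mem_coe, Set.mem_ofPred_eq,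
    pow_zero]
  exact and_comm

/-- The leading factor of either resultant is a unit, so only the product over the zeros matters for
the norm. -/
theorem norm_pow_mul_of_isUnit {F : (ringInt K)⟦X⟧} {n : ℕ}
    (hn : IsUnit (PowerSeries.coeff n F)) (N : ℕ) (x : ℂ_[p]) :
    ‖PowerSeries.coeff n (toCp F) ^ N * x‖ = ‖x‖ := by
  rw [coeff_toCp, norm_mul, norm_pow, (isUnit_iff_norm_eq _).mp hn, one_pow, one_mul]

end Main

end PadicResultant

theorem theorem3p4 (p : ℕ) [Fact p.Prime] (K : IntermediateField ℚ_[p] ℂ_[p])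
    [FiniteDimensional ℚ_[p] K]
    (π : ringInt K) (hπ : IsLocalRing.maximalIdeal (ringInt K) = Ideal.span {π})
    (F G : (ringInt K)⟦X⟧)
    (hF : HasFiniteWideg (toCp F)) (hG : HasFiniteWideg (toCp G))
    (hFu : IsUnit (PowerSeries.coeff (wideg (toCp F)) F))
    (hGu : IsUnit (PowerSeries.coeff (wideg (toCp G)) G)) :
    -- the open unit disc
    ((∀ z ∈ Metric.ball (0 : ℂ_[p]) 1 ∩ (K : Set ℂ_[p]),
        ¬ (evalAt (toCp F) z = 0 ∧ evalAt (toCp G) z = 0)) →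
      ∃ S s : ℕ,
        -- extreme values of `φ` on the open disc of `K` for `v_π` and for `v_p`
        IsMaxMin K (incl K π) (Metric.ball 0 1) (toCp F) (toCp G) S s ∧
        IsMaxMin K (p : ℂ_[p]) (Metric.ball 0 1) (toCp F) (toCp G)
          (S / ramIndex π) (s / ramIndex π) ∧
        ∀ t : ℕ,
          val (incl K π) (resO (toCp F) (toCp G))
              - ((S : ℝ) : EReal) ≥
            (((bigB' p (residueDeg K) (s + t) : ℝ)
              - 2 * bigB' p (residueDeg K) t - s : ℝ) : EReal) ∧
          val (p : ℂ_[p]) (resO (toCp F) (toCp G))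
              - ((S / ramIndex π : ℝ) : EReal) ≥
            ((1 / ramIndex π *
              ((bigB' p (residueDeg K) (s + t) : ℝ)
              - 2 * bigB' p (residueDeg K) t - s) : ℝ) : EReal)) ∧
    -- the closed unit disc
    (ConvergesOn (toCp F) (Metric.closedBall 0 1) →
      ConvergesOn (toCp G) (Metric.closedBall 0 1) →
      (∀ z ∈ Metric.closedBall (0 : ℂ_[p]) 1 ∩ (K : Set ℂ_[p]),
        ¬ (evalAt (toCp F) z = 0 ∧ evalAt (toCp G) z = 0)) →
      ∃ S s : ℕ,
        -- extreme values of `φ` on the ring of integers of `K` for `v_π` and for `v_p`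
        IsMaxMin K (incl K π) (Metric.closedBall 0 1) (toCp F) (toCp G) S s ∧
        IsMaxMin K (p : ℂ_[p]) (Metric.closedBall 0 1) (toCp F) (toCp G)
          (S / ramIndex π) (s / ramIndex π) ∧
        ∀ t : ℕ,
          val (incl K π) (resC (toCp F) (toCp G))
              - ((S : ℝ) : EReal) ≥
            (((bigB p (residueDeg K) (s + t) : ℝ)
              - 2 * bigB p (residueDeg K) t - s : ℝ) : EReal) ∧
          val (p : ℂ_[p]) (resC (toCp F) (toCp G))
              - ((S / ramIndex π : ℝ) : EReal) ≥
            ((1 / ramIndex π *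
              ((bigB p (residueDeg K) (s + t) : ℝ)
              - 2 * bigB p (residueDeg K) t - s) : ℝ) : EReal)) := by

  have hr := norm_prime_eq_pow hπ
  have he := ramIndex_pos hπ
  have hone : ‖incl K π‖ = ‖incl K π‖ ^ 1 := (pow_one _).symm
  refine ⟨fun hFG => ?_, fun hFc hGc hFG => ?_⟩
  · obtain ⟨P, U, HF⟩ := exists_isPrepared_ball hπ F hFu
    obtain ⟨Q, V, HG⟩ := exists_isPrepared_ball hπ G hGu
    -- On `𝔪_K = π 𝒪_K` each of the `j` factors gains one `π`, which turns `α` into `α'`.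
    obtain ⟨S, s, H⟩ := exists_isMaxMin_and_bound hπ 1 (ball_inter_eq hπ)
      (a := alpha' p (residueDeg K)) (fun j => by rw [one_mul]; rfl) HF HG hFG
      (ρ := resO (toCp F) (toCp G)) (norm_pow_mul_of_isUnit hFu _ _)
    have H1 := H _ 1 one_pos hone
    have H2 := H _ _ he hr
    simp only [Nat.cast_one, div_one, one_mul] at H1
    exact ⟨S, s, H1.1, H2.1, fun t => ⟨H1.2 t, H2.2 t⟩⟩
  · have hFr := (isRestrictedAt_iff_tendsto hπ F).mpr (tendsto_coeff_of_convergesOn hFc)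
    have hGr := (isRestrictedAt_iff_tendsto hπ G).mpr (tendsto_coeff_of_convergesOn hGc)
    obtain ⟨P, U, HF⟩ := exists_isPrepared_closedBall hπ F hFu hFr
    obtain ⟨Q, V, HG⟩ := exists_isPrepared_closedBall hπ G hGu hGr
    obtain ⟨S, s, H⟩ := exists_isMaxMin_and_bound hπ 0 (closedBall_inter_eq π)
      (a := alpha p (residueDeg K)) (fun j => by rw [zero_mul, zero_add]) HF HG hFG
      (ρ := resC (toCp F) (toCp G)) (norm_pow_mul_of_isUnit (lwideg_spec hπ hFu hFr).1 _ _)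
    have H1 := H _ 1 one_pos hone
    have H2 := H _ _ he hr
    simp only [Nat.cast_one, div_one, one_mul] at H1
    exact ⟨S, s, H1.1, H2.1, fun t => ⟨H1.2 t, H2.2 t⟩⟩
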